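/- Let $a_1,a_2>0$ and, for $j\in\{1,2\}$, let $\chi_j\in C^2(-a_j,a_j)\cap C^1[-a_j,a_j]$ be real-valued with $\chi_j(0)=0$. Let $\Omega\subset[-a_1,a_1]\times[-a_2,a_2]$ be an open set which together with any point $(x,y)$ contains the closed rectangle with vertices $(\pm x,\pm y)$ (such a set is star-shaped about the origin, hence, if non-empty, a simply connected domain). Let $\chi(x_1,x_2)=\chi_1(x_1)+\chi_2(x_2)$ be the (separable) superpotential. *Hamiltonians.* Put $q_i^{\pm}=\mp\partial_i+\partial_i\chi$ and $p_i^{\pm}=\sum_{k=1}^2\epsilon_{ik}q_k^{\mp}$, where $\epsilon_{12}=1=-\epsilon_{21}$, $\epsilon_{11}=\epsilon_{22}=0$, and $$H^{(0)}=\sum_k q_k^+q_k^-=-\Delta+\sum_k\big((\partial_k\chi)^2-\partial_k^2\chi\big),\qquad H^{(2)}=\sum_k p_k^+p_k^-=-\Delta+\sum_k\big((\partial_k\chi)^2+\partial_k^2\chi\big),$$ $$H=\mathrm{diag}(H^{(0)},H^{(2)}),\qquad H^{(1)}=\big(H^{(1)}_{ij}\big)_{i,j=1}^2,\quad H^{(1)}_{ij}=q_i^-q_j^++p_i^-p_j^+=\delta_{ij}H^{(0)}+2\partial_i\partial_j\chi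 .$$ For complex-valued $w$ put $Pw=(\operatorname{Im}w,\operatorname{Re}w)^\top$. *Transmutation operators.* Put $q_j=\chi_j''+(\chi_j')^2$ on $(-a_j,a_j)$ and $h_j=(\mathrm e^{\chi_j})'(0)$. Let $K_j(x,t)$, $|x|,|t|<a_j$, be the unique $C^1$ solution of the Goursat problem $$\big(\partial_x^2-q_j(x)\big)K_j(x,t)=\partial_t^2K_j(x,t),\qquad K_j(x,x)=\tfrac12\int_0^xq_j(s)\,\mathrm ds,\qquad K_j(x,-x)=0,$$ where the equation is understood in characteristic coordinates, i.e. $\partial_u\partial_v\big[K_j(u+v,u-v)\big]=q_j(u+v)K_j(u+v,u-v)$. Put $$\mathbf K_j(x,t;h_j)=\frac{h_j}2+K_j(x,t)+\frac{h_j}2\int_t^x\big[K_j(x,s)-K_j(x,-s)\big]\mathrm ds,$$ $$\widetilde{\mathbf K}_j(x,t;-h_j)=-\mathrm e^{-\chi_j(x)}\Big(\int_{-t}^x\partial_t\mathbf K_j(s,t;h_j)\,\mathrm e^{\chi_j(s)}\,\mathrm ds+\frac{h_j}2\mathrm e^{\chi_j(-t)}\Big),$$ $$T_jf(x)=f(x)+\int_{-x}^x\mathbf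 K_j(x,t;h_j)f(t)\,\mathrm dt,\qquad \widetilde T_jf(x)=f(x)+\int_{-x}^x\widetilde{\mathbf K}_j(x,t;-h_j)f(t)\,\mathrm dt .$$ On functions of $(x_1,x_2)$, the operators $T_j,\widetilde T_j$ act in the variable $x_j$. Put $$\mathbf T_0w=T_1T_2\operatorname{Re}w+\mathrm i\,\widetilde T_1\widetilde T_2\operatorname{Im}w,\qquad \mathbf T_1w=\widetilde T_1T_2\operatorname{Re}w+\mathrm i\,T_1\widetilde T_2\operatorname{Im}w .$$ **Claim.** For every complex-valued $w\in C^2(\Omega)$ the functions $\mathbf T_0w$ and $\mathbf T_1w$ belong to $C^2(\Omega)$, and in $\Omega$ $$HP\mathbf T_0w=-P\mathbf T_0\Delta w\qquad\text{and}\qquad H^{(1)}P\mathbf T_1w=-P\mathbf T_1\Delta w .$$ -/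

import Mathlib

open Set MeasureTheory

noncomputable section

namespace SUSY

/-! ### Partial derivatives and the Laplacian in the plane `ℝ × ℝ` -/

/-- The partial derivative `∂₁` (index `0`) or `∂₂` (index `1`). -/
def partialD {E : Type*} [NormedAddCommGroup E] [NormedSpace ℝ E]
    (i : Fin 2) (f : ℝ × ℝ → E) (p : ℝ × ℝ) : E :=
  if i = 0 then deriv (fun s : ℝ => f (s, p.2)) p.1 else deriv (fun s : ℝ => f (p.1, s)) p.2

/-- The Laplacian `Δ = ∂₁² + ∂₂²`. -/
def laplace {E : Type*} [NormedAddCommGroup E] [NormedSpace ℝ E]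
    (f : ℝ × ℝ → E) (p : ℝ × ℝ) : E :=
  ∑ k : Fin 2, partialD k (partialD k f) p

/-! ### The components of the supercharges and the superhamiltonian -/

/-- `q_i^+ = -∂_i + ∂_i χ`. -/
def qPlus (χ : ℝ × ℝ → ℝ) (i : Fin 2) (f : ℝ × ℝ → ℝ) (p : ℝ × ℝ) : ℝ :=
  -partialD i f p + partialD i χ p * f p

/-- `q_i^- = ∂_i + ∂_i χ`. -/
def qMinus (χ : ℝ × ℝ → ℝ) (i : Fin 2) (f : ℝ × ℝ → ℝ) (p : ℝ × ℝ) : ℝ :=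
  partialD i f p + partialD i χ p * f p

/-- The fundamental antisymmetric tensor, `ε₁₂ = 1 = -ε₂₁`. -/
def eps : Matrix (Fin 2) (Fin 2) ℝ := !![0, 1; -1, 0]

/-- `p_i^+ = ∑_k ε_{ik} q_k^-`. -/
def pPlus (χ : ℝ × ℝ → ℝ) (i : Fin 2) (f : ℝ × ℝ → ℝ) (p : ℝ × ℝ) : ℝ :=
  ∑ k : Fin 2, eps i k * qMinus χ k f p

/-- `p_i^- = ∑_k ε_{ik} q_k^+`. -/
def pMinus (χ : ℝ × ℝ → ℝ) (i : Fin 2) (f : ℝ × ℝ → ℝ) (p : ℝ × ℝ) : ℝ :=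
  ∑ k : Fin 2, eps i k * qPlus χ k f p

/-- The scalar Hamiltonian `H⁽⁰⁾ = ∑_k q_k^+ q_k^-`, that is, on `C²` functions,
`-Δ + ∑_k ((∂_k χ)² - ∂_k² χ)`. -/
def H0 (χ : ℝ × ℝ → ℝ) (f : ℝ × ℝ → ℝ) (p : ℝ × ℝ) : ℝ :=
  ∑ k : Fin 2, qPlus χ k (qMinus χ k f) p

/-- The scalar Hamiltonian `H⁽²⁾ = ∑_k p_k^+ p_k^-`, that is, on `C²` functions,
`-Δ + ∑_k ((∂_k χ)² + ∂_k² χ)`. -/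
def H2 (χ : ℝ × ℝ → ℝ) (f : ℝ × ℝ → ℝ) (p : ℝ × ℝ) : ℝ :=
  ∑ k : Fin 2, pPlus χ k (pMinus χ k f) p

/-- The diagonal operator `H = diag (H⁽⁰⁾, H⁽²⁾)`. -/
def H (χ : ℝ × ℝ → ℝ) (Ψ : Fin 2 → ℝ × ℝ → ℝ) : Fin 2 → ℝ × ℝ → ℝ :=
  ![H0 χ (Ψ 0), H2 χ (Ψ 1)]

/-- The entries `H⁽¹⁾_{ij} = q_i^- q_j^+ + p_i^- p_j^+` of the matrix Hamiltonian; on `C²`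
functions, `H⁽¹⁾_{ij} = δ_{ij} H⁽⁰⁾ + 2 ∂_i ∂_j χ`. -/
def H1entry (χ : ℝ × ℝ → ℝ) (i j : Fin 2) (f : ℝ × ℝ → ℝ) (p : ℝ × ℝ) : ℝ :=
  qMinus χ i (qPlus χ j f) p + pMinus χ i (pPlus χ j f) p

/-- The `2 × 2` matrix Hamiltonian `H⁽¹⁾`. -/
def H1 (χ : ℝ × ℝ → ℝ) (Φ : Fin 2 → ℝ × ℝ → ℝ) (i : Fin 2) (p : ℝ × ℝ) : ℝ :=
  ∑ j : Fin 2, H1entry χ i j (Φ j) p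

/-- `P w = (P⁻ w, P⁺ w)ᵀ = (Im w, Re w)ᵀ`. -/
def P (w : ℝ × ℝ → ℂ) : Fin 2 → ℝ × ℝ → ℝ :=
  ![fun p => (w p).im, fun p => (w p).re]

/-! ### The transmutation operators in one variable -/

/-- The potential `q = χ'' + (χ')²`. -/
def potential (χ : ℝ → ℝ) (x : ℝ) : ℝ := deriv (deriv χ) x + (deriv χ x) ^ 2

/-- The number `h = (e^χ)'(0)`. -/
def hConst (χ : ℝ → ℝ) : ℝ := deriv (fun x => Real.exp (χ x)) 0

/-- `K` solves the Goursat problem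
`(∂_x² - q(x)) K(x,t) = ∂_t² K(x,t)`, `K(x,x) = ½ ∫₀ˣ q(s) ds`, `K(x,-x) = 0`
on the square `|x| < a`, `|t| < a`.

As usual for a potential that is merely continuous (when `K` is in general only `C¹`), the
hyperbolic equation is written in the characteristic coordinates `x = u + v`, `t = u - v`, in which
`∂_x² - ∂_t²` is the mixed derivative `∂_u ∂_v`. -/
structure IsGoursatSolution (a : ℝ) (q : ℝ → ℝ) (K : ℝ → ℝ → ℝ) : Prop where
  contDiffOn : ContDiffOn ℝ 1 (fun p : ℝ × ℝ => K p.1 p.2) (Ioo (-a) a ×ˢ Ioo (-a) a)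
  pde : ∀ u v : ℝ, u + v ∈ Ioo (-a) a → u - v ∈ Ioo (-a) a →
    HasDerivAt (fun u' : ℝ => deriv (fun v' : ℝ => K (u' + v') (u' - v')) v)
      (q (u + v) * K (u + v) (u - v)) u
  diag : ∀ x ∈ Ioo (-a) a, K x x = (1 / 2) * ∫ s in (0 : ℝ)..x, q s
  antidiag : ∀ x ∈ Ioo (-a) a, K x (-x) = 0

/-- The solution `K(x,t)` of the Goursat problem for `q = χ'' + (χ')²`; on the square `|x| < a`,
`|t| < a` it is unique. -/
def kernelK (a : ℝ) (χ : ℝ → ℝ) : ℝ → ℝ → ℝ :=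
  Classical.epsilon (fun K : ℝ → ℝ → ℝ => IsGoursatSolution a (potential χ) K)

/-- The kernel
`𝐊(x,t;h) = h/2 + K(x,t) + (h/2) ∫_t^x (K(x,s) - K(x,-s)) ds`. -/
def kernelKh (a : ℝ) (χ : ℝ → ℝ) (x t : ℝ) : ℝ :=
  hConst χ / 2 + kernelK a χ x t
    + hConst χ / 2 * ∫ s in t..x, (kernelK a χ x s - kernelK a χ x (-s))

/-- The transmutation operator `T f(x) = f(x) + ∫_{-x}^x 𝐊(x,t;h) f(t) dt`. -/
def T (a : ℝ) (χ : ℝ → ℝ) (f : ℝ → ℝ) (x : ℝ) : ℝ :=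
  f x + ∫ t in (-x)..x, kernelKh a χ x t * f t

/-- The kernel
`𝐊~(x,t;-h) = -e^{-χ(x)} (∫_{-t}^x ∂_t 𝐊(s,t;h) e^{χ(s)} ds + (h/2) e^{χ(-t)})`. -/
def kernelKtilde (a : ℝ) (χ : ℝ → ℝ) (x t : ℝ) : ℝ :=
  -Real.exp (-χ x) *
    ((∫ s in (-t)..x, deriv (fun τ => kernelKh a χ s τ) t * Real.exp (χ s))
      + hConst χ / 2 * Real.exp (χ (-t)))

/-- The transmutation operator `T~ f(x) = f(x) + ∫_{-x}^x 𝐊~(x,t;-h) f(t) dt`. -/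
def Ttilde (a : ℝ) (χ : ℝ → ℝ) (f : ℝ → ℝ) (x : ℝ) : ℝ :=
  f x + ∫ t in (-x)..x, kernelKtilde a χ x t * f t

/-! ### The transmutation operators in the plane -/

/-- An operator on functions of one variable, applied in the first variable. -/
def inX (S : (ℝ → ℝ) → ℝ → ℝ) (f : ℝ × ℝ → ℝ) (p : ℝ × ℝ) : ℝ :=
  S (fun s => f (s, p.2)) p.1

/-- An operator on functions of one variable, applied in the second variable. -/
def inY (S : (ℝ → ℝ) → ℝ → ℝ) (f : ℝ × ℝ → ℝ) (p : ℝ × ℝ) : ℝ :=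
  S (fun s => f (p.1, s)) p.2

/-- `𝐓₀ = T₁ T₂ P⁺ + i T~₁ T~₂ P⁻`. -/
def bT0 (a₁ a₂ : ℝ) (χ₁ χ₂ : ℝ → ℝ) (w : ℝ × ℝ → ℂ) (p : ℝ × ℝ) : ℂ :=
  (inX (T a₁ χ₁) (inY (T a₂ χ₂) (fun z => (w z).re)) p : ℂ)
    + Complex.I * (inX (Ttilde a₁ χ₁) (inY (Ttilde a₂ χ₂) (fun z => (w z).im)) p : ℂ)

/-- `𝐓₁ = T~₁ T₂ P⁺ + i T₁ T~₂ P⁻`. -/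
def bT1 (a₁ a₂ : ℝ) (χ₁ χ₂ : ℝ → ℝ) (w : ℝ × ℝ → ℂ) (p : ℝ × ℝ) : ℂ :=
  (inX (Ttilde a₁ χ₁) (inY (T a₂ χ₂) (fun z => (w z).re)) p : ℂ)
    + Complex.I * (inX (T a₁ χ₁) (inY (Ttilde a₂ χ₂) (fun z => (w z).im)) p : ℂ)

/-- Together with any point `(x, y)`, the set contains the closed rectangle with vertices
`(x, y)`, `(-x, y)`, `(x, -y)`, `(-x, -y)`. -/
def IsRectSymmetric (Ω : Set (ℝ × ℝ)) : Prop :=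
  ∀ p ∈ Ω, ∀ s t : ℝ, |s| ≤ |p.1| → |t| ≤ |p.2| → (s, t) ∈ Ω

end SUSY

end

noncomputable section

namespace SUSY

open Filter Topology intervalIntegral

/-! ### Calculus with continuous partial derivatives -/

/-! In one variable let `k`, `l` be the kernels of T and T~ and c = χ'. Everything rests on the two
first-order relations (∂ - c) T = T~ ∂ and (∂ + c) T~ = T ∂ (`IsDarbouxPair.hasDerivAt_volterra`,
applied also to `IsDarbouxPair.symm`). In the plane, operators in one variable commute with
differentiation and multiplication in the other. So, up to sign, each `qPlus` or `qMinus` becomes a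
plain partial derivative and exchanges T with T~ in its own variable. Composing two of them yields
minus the Laplacian, and the mixed terms of the matrix Hamiltonian cancel by symmetry of second
derivatives (`H0_planeVolterra`, `H2_planeVolterra`, `H1_planeVolterra_zero`,
`H1_planeVolterra_one`). The same relations give C² regularity, since they move the derivative from
the kernel to the function.

The work lies in showing that the kernels form such a Darboux pair when the potential q is only
continuous and K only C¹. In the coordinates x = u + v, t = u - v the Goursat problem is the
integral equation W = g + ∬ q W. The kernel 𝐊 solves it with data raised by h/2
(`IsGoursatIntegral.shift`). With M denoting 𝐊 and f = e^χ, so that f'' = q f, the form M f' du + f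
M_v dv is closed. Its potential Φ yields the partner l = -M + 2 Φ / f (`exists_isDarbouxPair`), and
integrating the first-order equation of l recovers the formula for 𝐊~
(`IsDarbouxPair.second_kernel_eq`).

Since q may blow up at the ends of the interval, χ is first cut off to a compactly supported C²
function. A weighted contraction then solves the integral equation globally, and uniqueness on
diamonds identifies the solution with `kernelK` on a smaller square (`exists_isGoursatSolution`,
`kernelK_eq`). All operators involved are local to symmetric rectangles, so the global identities
apply near each point of Ω (`transmutation_at`). -/

theorem hasStrictFDerivAt_of_partials {f fx fy : ℝ × ℝ → ℝ}
    (hx : ∀ p : ℝ × ℝ, HasDerivAt (fun s => f (s, p.2)) (fx p) p.1)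
    (hy : ∀ p : ℝ × ℝ, HasDerivAt (fun s => f (p.1, s)) (fy p) p.2)
    (cx : Continuous fx) (cy : Continuous fy) (p : ℝ × ℝ) :
    HasStrictFDerivAt f ((ContinuousLinearMap.toSpanSingleton ℝ (fx p)).coprod
      (ContinuousLinearMap.toSpanSingleton ℝ (fy p))) p := by
  have h := hasStrictFDerivAt_uncurry_coprod (𝕜 := ℝ) (u := p) (f := fun s t => f (s, t))
    (f₁ := fun s t => ContinuousLinearMap.toSpanSingleton ℝ (fx (s, t)))
    (f₂ := fun s t => ContinuousLinearMap.toSpanSingleton ℝ (fy (s, t)))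
    (Eventually.of_forall fun v => (hx v).hasFDerivAt)
    (Eventually.of_forall fun v => (hy v).hasFDerivAt)
    (((ContinuousLinearMap.toSpanSingletonCLE (𝕜 := ℝ) (E := ℝ)).continuous.comp cx).continuousAt)
    (((ContinuousLinearMap.toSpanSingletonCLE (𝕜 := ℝ) (E := ℝ)).continuous.comp cy).continuousAt)
  exact h

theorem contDiff_succ_of_partials {n : ℕ} {f fx fy : ℝ × ℝ → ℝ}
    (hx : ∀ p : ℝ × ℝ, HasDerivAt (fun s => f (s, p.2)) (fx p) p.1)
    (hy : ∀ p : ℝ × ℝ, HasDerivAt (fun s => f (p.1, s)) (fy p) p.2)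
    (cx : ContDiff ℝ n fx) (cy : ContDiff ℝ n fy) : ContDiff ℝ (n + 1) f := by
  rw [contDiff_succ_iff_hasFDerivAt]
  refine ⟨fun p => (ContinuousLinearMap.toSpanSingleton ℝ (fx p)).coprod
    (ContinuousLinearMap.toSpanSingleton ℝ (fy p)), ?_, fun p =>
    (hasStrictFDerivAt_of_partials hx hy cx.continuous cy.continuous p).hasFDerivAt⟩
  have e : (fun p => (ContinuousLinearMap.toSpanSingleton ℝ (fx p)).coprod
      (ContinuousLinearMap.toSpanSingleton ℝ (fy p))) = fun p =>
      fx p • ContinuousLinearMap.fst ℝ ℝ ℝ + fy p • ContinuousLinearMap.snd ℝ ℝ ℝ := by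
    funext p
    ext <;> simp
  rw [e]
  exact (cx.smul contDiff_const).add (cy.smul contDiff_const)

theorem hasDerivAt_comp_of_partials {f fx fy : ℝ × ℝ → ℝ}
    (hx : ∀ p : ℝ × ℝ, HasDerivAt (fun s => f (s, p.2)) (fx p) p.1)
    (hy : ∀ p : ℝ × ℝ, HasDerivAt (fun s => f (p.1, s)) (fy p) p.2)
    (cx : Continuous fx) (cy : Continuous fy) {a b : ℝ → ℝ} {a' b' s : ℝ}
    (ha : HasDerivAt a a' s) (hb : HasDerivAt b b' s) :
    HasDerivAt (fun s => f (a s, b s)) (a' * fx (a s, b s) + b' * fy (a s, b s)) s := by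
  have h := (hasStrictFDerivAt_of_partials hx hy cx cy (a s, b s)).hasFDerivAt.comp_hasDerivAt s
    (ha.prodMk hb)
  refine h.congr_deriv ?_
  simp

/-- Differentiation under the integral sign, fixed limits. -/
theorem hasDerivAt_integral_param {g g' : ℝ → ℝ → ℝ} (hg : ∀ x, Continuous (g x))
    (hg' : Continuous (Function.uncurry g'))
    (hd : ∀ x t, HasDerivAt (fun x => g x t) (g' x t) x) (a b x : ℝ) :
    HasDerivAt (fun x => ∫ t in a..b, g x t) (∫ t in a..b, g' x t) x := by
  obtain ⟨C, hC⟩ := ((isCompact_Icc (a := x - 1) (b := x + 1)).prod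
    (isCompact_uIcc (a := a) (b := b))).exists_bound_of_continuousOn hg'.continuousOn
  have c' : ∀ x, Continuous (g' x) := fun x => hg'.comp (by fun_prop : Continuous fun t => (x, t))
  refine (intervalIntegral.hasDerivAt_integral_of_dominated_loc_of_deriv_le (F := g) (F' := g')
    (bound := fun _ => C) (s := Icc (x - 1) (x + 1)) (Icc_mem_nhds (by linarith) (by linarith))
    (Eventually.of_forall fun y => (hg y).aestronglyMeasurable)
    ((hg x).intervalIntegrable _ _) (c' x).aestronglyMeasurable
    (Eventually.of_forall fun t ht y hy => hC (y, t) ⟨hy, uIoc_subset_uIcc ht⟩)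
    (by simp) (Eventually.of_forall fun t _ y _ => hd y t)).2

/-- Leibniz' rule with moving limits. -/
theorem hasDerivAt_integral_moving {g g' : ℝ → ℝ → ℝ} (hg : Continuous (Function.uncurry g))
    (hg' : Continuous (Function.uncurry g'))
    (hd : ∀ x t, HasDerivAt (fun x => g x t) (g' x t) x) {a b : ℝ → ℝ} {a' b' x : ℝ}
    (ha : HasDerivAt a a' x) (hb : HasDerivAt b b' x) :
    HasDerivAt (fun x => ∫ t in a x..b x, g x t)
      (b' * g x (b x) - a' * g x (a x) + ∫ t in a x..b x, g' x t) x := by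
  have c : ∀ x, Continuous (g x) := fun x => hg.comp (by fun_prop : Continuous fun t => (x, t))
  have c' : ∀ x, Continuous (g' x) := fun x => hg'.comp (by fun_prop : Continuous fun t => (x, t))
  -- With lower limit 0 the integral is a function of the pair (x, b) with continuous partials, so
  -- the chain rule applies.
  have key : ∀ {b : ℝ → ℝ} {b' : ℝ}, HasDerivAt b b' x →
      HasDerivAt (fun x => ∫ t in (0 : ℝ)..b x, g x t)
        ((∫ t in (0 : ℝ)..b x, g' x t) + b' * g x (b x)) x := by
    intro b b' hb
    have := hasDerivAt_comp_of_partials (f := fun p => ∫ t in (0 : ℝ)..p.2, g p.1 t)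
      (fx := fun p => ∫ t in (0 : ℝ)..p.2, g' p.1 t) (fy := fun p => g p.1 p.2)
      (fun p => hasDerivAt_integral_param c hg' hd 0 p.2 p.1)
      (fun p => integral_hasDerivAt_right ((c p.1).intervalIntegrable _ _)
        ((c p.1).stronglyMeasurableAtFilter _ _) (c p.1).continuousAt)
      (continuous_parametric_intervalIntegral_of_continuous
        (f := fun (p : ℝ × ℝ) t => g' p.1 t)
        (hg'.comp (by fun_prop : Continuous fun q : (ℝ × ℝ) × ℝ => (q.1.1, q.2)))
        continuous_snd) (hg.comp (by fun_prop : Continuous fun q : ℝ × ℝ => (q.1, q.2)))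
      (hasDerivAt_id x) hb
    simpa using this
  have e : ∀ (G : ℝ → ℝ → ℝ), (∀ x, Continuous (G x)) → ∀ x, ∫ t in a x..b x, G x t
      = (∫ t in (0 : ℝ)..b x, G x t) - ∫ t in (0 : ℝ)..a x, G x t := fun G hG x =>
    (integral_interval_sub_left ((hG x).intervalIntegrable _ _)
      ((hG x).intervalIntegrable _ _)).symm
  rw [funext (e g c), e g' c']
  exact ((key hb).sub (key ha)).congr_deriv (by ring)

theorem continuous_integral_moving {X : Type*} [TopologicalSpace X] [FirstCountableTopology X]
    {g : X → ℝ → ℝ} (hg : Continuous (Function.uncurry g)) {a b : X → ℝ}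
    (ha : Continuous a) (hb : Continuous b) : Continuous fun x => ∫ t in a x..b x, g x t := by
  have c : ∀ x, Continuous (g x) := fun x => hg.comp (by fun_prop : Continuous fun t => (x, t))
  have e : ∀ x, ∫ t in a x..b x, g x t
      = (∫ t in (0 : ℝ)..b x, g x t) - ∫ t in (0 : ℝ)..a x, g x t := fun x =>
    (integral_interval_sub_left ((c x).intervalIntegrable _ _)
      ((c x).intervalIntegrable _ _)).symm
  simp only [e]
  exact (continuous_parametric_intervalIntegral_of_continuous hg hb).sub
    (continuous_parametric_intervalIntegral_of_continuous hg ha)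

theorem hasDerivAt_primitive {g : ℝ → ℝ} (hg : Continuous g) (a x : ℝ) :
    HasDerivAt (fun x => ∫ t in a..x, g t) (g x) x :=
  integral_hasDerivAt_right (hg.intervalIntegrable _ _) (hg.stronglyMeasurableAtFilter _ _)
    hg.continuousAt

/-- Identities between iterated integrals are proved below by differentiating both sides in one
parameter and comparing at a single point; this replaces Fubini and Green. -/
theorem eq_of_hasDerivAt_eq {f g f' : ℝ → ℝ} (hf : ∀ x, HasDerivAt f (f' x) x)
    (hg : ∀ x, HasDerivAt g (f' x) x) {a : ℝ} (h : f a = g a) (x : ℝ) : f x = g x := by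
  have hd : ∀ x, HasDerivAt (fun x => f x - g x) 0 x := fun x =>
    ((hf x).sub (hg x)).congr_deriv (sub_self _)
  have := is_const_of_deriv_eq_zero (fun x => (hd x).differentiableAt) (fun x => (hd x).deriv) x a
  linarith

/-! ### Partial derivatives of smooth functions -/

theorem partialD_zero (f : ℝ × ℝ → ℝ) (p : ℝ × ℝ) :
    partialD 0 f p = deriv (fun s => f (s, p.2)) p.1 := by simp [partialD]

theorem partialD_one (f : ℝ × ℝ → ℝ) (p : ℝ × ℝ) :
    partialD 1 f p = deriv (fun s => f (p.1, s)) p.2 := by simp [partialD]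

theorem hasDerivAt_partialD_zero {f : ℝ × ℝ → ℝ} {p : ℝ × ℝ} (hf : DifferentiableAt ℝ f p) :
    HasDerivAt (fun s => f (s, p.2)) (partialD 0 f p) p.1 := by
  have h : DifferentiableAt ℝ (fun s => f (s, p.2)) p.1 :=
    DifferentiableAt.comp (g := f) p.1 hf (by fun_prop)
  simpa [partialD] using h.hasDerivAt

theorem hasDerivAt_partialD_one {f : ℝ × ℝ → ℝ} {p : ℝ × ℝ} (hf : DifferentiableAt ℝ f p) :
    HasDerivAt (fun s => f (p.1, s)) (partialD 1 f p) p.2 := by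
  have h : DifferentiableAt ℝ (fun s => f (p.1, s)) p.2 :=
    DifferentiableAt.comp (g := f) p.2 hf (by fun_prop)
  simpa [partialD] using h.hasDerivAt

theorem partialD_eq_fderiv {f : ℝ × ℝ → ℝ} {p : ℝ × ℝ} (hf : DifferentiableAt ℝ f p)
    (i : Fin 2) : partialD i f p = fderiv ℝ f p (if i = 0 then (1, 0) else (0, 1)) := by
  fin_cases i
  · have h : HasDerivAt (fun s => f (s, p.2)) (fderiv ℝ f p (1, 0)) p.1 :=
      HasFDerivAt.comp_hasDerivAt (l := f) p.1 hf.hasFDerivAt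
        ((hasDerivAt_id p.1).prodMk (hasDerivAt_const p.1 p.2))
    exact (hasDerivAt_partialD_zero hf).unique h
  · have h : HasDerivAt (fun s => f (p.1, s)) (fderiv ℝ f p (0, 1)) p.2 :=
      HasFDerivAt.comp_hasDerivAt (l := f) p.2 hf.hasFDerivAt
        ((hasDerivAt_const p.2 p.1).prodMk (hasDerivAt_id p.2))
    exact (hasDerivAt_partialD_one hf).unique h

theorem contDiff_partialD {n : ℕ} {f : ℝ × ℝ → ℝ} (hf : ContDiff ℝ (n + 1) f) (i : Fin 2) :
    ContDiff ℝ n (partialD i f) := by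
  rw [funext fun p => partialD_eq_fderiv
    ((hf.differentiable (by simp)).differentiableAt (x := p)) i]
  exact (hf.fderiv_right le_rfl).clm_apply contDiff_const

/-! ### Darboux pairs of Volterra operators -/

/-- The Volterra operator `f ↦ f(x) + ∫_{-x}^x k(x,t) f(t) dt`. -/
def volterra (k : ℝ → ℝ → ℝ) (f : ℝ → ℝ) (x : ℝ) : ℝ :=
  f x + ∫ t in (-x)..x, k x t * f t

/-- Kernels `k`, `l` with `(∂_x - c) k = -∂_t l`, `(∂_x + c) l = -∂_t k` and matching values on
the two diagonals. -/
structure IsDarbouxPair (c : ℝ → ℝ) (b : ℝ) (k l kt lt : ℝ → ℝ → ℝ) : Prop where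
  cont_c : Continuous c
  cont_k : Continuous (Function.uncurry k)
  cont_l : Continuous (Function.uncurry l)
  cont_kt : Continuous (Function.uncurry kt)
  cont_lt : Continuous (Function.uncurry lt)
  deriv_t_k : ∀ x t, HasDerivAt (fun τ => k x τ) (kt x t) t
  deriv_t_l : ∀ x t, HasDerivAt (fun τ => l x τ) (lt x t) t
  deriv_x_k : ∀ x t, HasDerivAt (fun s => k s t) (c x * k x t - lt x t) x
  deriv_x_l : ∀ x t, HasDerivAt (fun s => l s t) (-c x * l x t - kt x t) x
  antidiag_k : ∀ x, k x (-x) = b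
  antidiag_l : ∀ x, l x (-x) = -b
  diag : ∀ x, l x x = k x x - c x

section darboux

variable {c : ℝ → ℝ} {b : ℝ} {k l kt lt : ℝ → ℝ → ℝ}

/-- Corresponds to χ ↦ -χ. Every statement about the first kernel thus transfers to the second. -/
theorem IsDarbouxPair.symm (h : IsDarbouxPair c b k l kt lt) :
    IsDarbouxPair (fun x => -c x) (-b) l k lt kt where
  cont_c := h.cont_c.neg
  cont_k := h.cont_l
  cont_l := h.cont_k
  cont_kt := h.cont_lt
  cont_lt := h.cont_kt
  deriv_t_k := h.deriv_t_l
  deriv_t_l := h.deriv_t_k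
  deriv_x_k := h.deriv_x_l
  deriv_x_l x t := by simpa using h.deriv_x_k x t
  antidiag_k := h.antidiag_l
  antidiag_l x := by rw [h.antidiag_k, neg_neg]
  diag x := by rw [h.diag]; ring

/-- The intertwining relation `(∂ - c) (1 + k) f = (1 + l) f'`. -/
theorem IsDarbouxPair.hasDerivAt_volterra (h : IsDarbouxPair c b k l kt lt) {f f' : ℝ → ℝ}
    (hf : ∀ t, HasDerivAt f (f' t) t) (hf' : Continuous f') (x : ℝ) :
    HasDerivAt (volterra k f) (c x * volterra k f x + volterra l f' x) x := by
  have cf : Continuous f := continuous_iff_continuousAt.2 fun t => (hf t).continuousAt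
  have ck : Continuous fun t => k x t := h.cont_k.comp (by fun_prop : Continuous fun t => (x, t))
  have cl : Continuous fun t => l x t := h.cont_l.comp (by fun_prop : Continuous fun t => (x, t))
  have clt : Continuous fun t => lt x t :=
    h.cont_lt.comp (by fun_prop : Continuous fun t => (x, t))
  have hck := h.cont_k
  have hclt := h.cont_lt
  have hcc := h.cont_c
  have D := hasDerivAt_integral_moving (g := fun x t => k x t * f t)
    (g' := fun x t => (c x * k x t - lt x t) * f t)
    (a := fun x => -x) (b := fun x => x) (x := x)
    (hck.mul (cf.comp continuous_snd))
    ((((hcc.comp continuous_fst).mul hck).sub hclt).mul (cf.comp continuous_snd))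
    (fun x t => (h.deriv_x_k x t).mul_const (f t)) (hasDerivAt_id x).neg (hasDerivAt_id x)
  have ibp : ∫ t in (-x)..x, l x t * f' t = l x x * f x - l x (-x) * f (-x)
      - ∫ t in (-x)..x, lt x t * f t :=
    integral_mul_deriv_eq_deriv_mul (fun t _ => h.deriv_t_l x t) (fun t _ => hf t)
      (clt.intervalIntegrable _ _) (hf'.intervalIntegrable _ _)
  have split : ∫ t in (-x)..x, (c x * k x t - lt x t) * f t
      = c x * (∫ t in (-x)..x, k x t * f t) - ∫ t in (-x)..x, lt x t * f t := by
    rw [← intervalIntegral.integral_const_mul, ← intervalIntegral.integral_sub]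
    · exact integral_congr fun t _ => by ring
    · exact (continuous_const.mul (ck.mul cf)).intervalIntegrable _ _
    · exact (clt.mul cf).intervalIntegrable _ _
  refine ((hf x).add D).congr_deriv ?_
  simp only [volterra]
  -- Boundary terms: at t = -x the values b and -b cancel, and at t = x the difference k - l = c
  -- supplies the missing c f(x).
  rw [ibp, split, h.antidiag_k, h.antidiag_l, h.diag]
  ring

/-! ### Volterra operators in the plane -/

theorem continuous_inX_volterra (hk : Continuous (Function.uncurry k)) {f : ℝ × ℝ → ℝ}
    (hf : Continuous f) : Continuous (inX (volterra k) f) := by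
  refine Continuous.add (f := fun p : ℝ × ℝ => f (p.1, p.2)) (by fun_prop) ?_
  refine continuous_integral_moving (g := fun (p : ℝ × ℝ) t => k p.1 t * f (t, p.2))
    (Continuous.mul (f := fun q : (ℝ × ℝ) × ℝ => k q.1.1 q.2)
      (hk.comp (by fun_prop : Continuous fun q : (ℝ × ℝ) × ℝ => (q.1.1, q.2)))
      (by fun_prop)) (by fun_prop) (by fun_prop)

theorem continuous_inY_volterra (hk : Continuous (Function.uncurry k)) {f : ℝ × ℝ → ℝ}
    (hf : Continuous f) : Continuous (inY (volterra k) f) :=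
  (continuous_inX_volterra hk (hf.comp continuous_swap)).comp continuous_swap

theorem hasDerivAt_inX_volterra_snd (hk : Continuous (Function.uncurry k)) {f : ℝ × ℝ → ℝ}
    (hf : ContDiff ℝ 1 f) (p : ℝ × ℝ) :
    HasDerivAt (fun s => inX (volterra k) f (p.1, s)) (inX (volterra k) (partialD 1 f) p) p.2 := by
  have ck : Continuous fun t => k p.1 t :=
    hk.comp (by fun_prop : Continuous fun t => (p.1, t))
  have cf := hf.continuous
  have cfy := (contDiff_partialD (n := 0) (by simpa using hf) 1).continuous
  have hd : ∀ q, HasDerivAt (fun s => f (q.1, s)) (partialD 1 f q) q.2 := fun q =>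
    hasDerivAt_partialD_one (hf.differentiable (by simp) q)
  exact (hd p).add (hasDerivAt_integral_param (g := fun y t => k p.1 t * f (t, y))
    (g' := fun y t => k p.1 t * partialD 1 f (t, y)) (fun y => by fun_prop)
    (Continuous.mul (f := fun q : ℝ × ℝ => k p.1 q.2) (by fun_prop) (by fun_prop))
    (fun y t => (hd (t, y)).const_mul _) (-p.1) p.1 p.2)

theorem IsDarbouxPair.hasDerivAt_inX_volterra_fst (h : IsDarbouxPair c b k l kt lt)
    {f : ℝ × ℝ → ℝ} (hf : ContDiff ℝ 1 f) (p : ℝ × ℝ) :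
    HasDerivAt (fun s => inX (volterra k) f (s, p.2))
      (c p.1 * inX (volterra k) f p + inX (volterra l) (partialD 0 f) p) p.1 := by
  have cfx := (contDiff_partialD (n := 0) (by simpa using hf) 0).continuous
  exact h.hasDerivAt_volterra (f := fun s => f (s, p.2)) (f' := fun s => partialD 0 f (s, p.2))
    (fun t => hasDerivAt_partialD_zero (p := (t, p.2)) (hf.differentiable (by simp) _))
    (by fun_prop) p.1

theorem IsDarbouxPair.contDiff_one_inX (h : IsDarbouxPair c b k l kt lt) {f : ℝ × ℝ → ℝ}
    (hf : ContDiff ℝ 1 f) : ContDiff ℝ 1 (inX (volterra k) f) := by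
  have cf (i) := (contDiff_partialD (n := 0) (by simpa using hf) i).continuous
  have := contDiff_succ_of_partials (n := 0) (h.hasDerivAt_inX_volterra_fst hf)
    (hasDerivAt_inX_volterra_snd h.cont_k hf)
    (contDiff_zero.2 (((h.cont_c.comp continuous_fst).mul
      (continuous_inX_volterra h.cont_k hf.continuous)).add
      (continuous_inX_volterra h.cont_l (cf 0))))
    (contDiff_zero.2 (continuous_inX_volterra h.cont_k (cf 1)))
  simpa using this

/-- No second derivative of a kernel is needed: the first-order relation expresses ∂₁ through the
two Volterra operators applied to f and ∂₁f, and these are C¹ by the previous step of the bootstrap.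
-/
theorem IsDarbouxPair.contDiff_two_inX (h : IsDarbouxPair c b k l kt lt) (hc : ContDiff ℝ 1 c)
    {f : ℝ × ℝ → ℝ} (hf : ContDiff ℝ 2 f) : ContDiff ℝ 2 (inX (volterra k) f) := by
  have h1 : ContDiff ℝ 1 f := hf.of_le (by norm_num)
  have cf (i) : ContDiff ℝ 1 (partialD i f) :=
    contDiff_partialD (n := 1) (hf.of_le (by norm_num)) i
  have := contDiff_succ_of_partials (n := 1) (h.hasDerivAt_inX_volterra_fst h1)
    (hasDerivAt_inX_volterra_snd h.cont_k h1)
    (((hc.comp contDiff_fst).mul (h.contDiff_one_inX h1)).add (h.symm.contDiff_one_inX (cf 0)))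
    (h.contDiff_one_inX (cf 1))
  exact this.of_le (by norm_num)

theorem IsDarbouxPair.contDiff_two_inY (h : IsDarbouxPair c b k l kt lt) (hc : ContDiff ℝ 1 c)
    {f : ℝ × ℝ → ℝ} (hf : ContDiff ℝ 2 f) : ContDiff ℝ 2 (inY (volterra k) f) :=
  (h.contDiff_two_inX hc (hf.comp (contDiff_snd.prodMk contDiff_fst))).comp
    (contDiff_snd.prodMk contDiff_fst)

theorem IsDarbouxPair.partialD_zero_inX (h : IsDarbouxPair c b k l kt lt)
    {f : ℝ × ℝ → ℝ} (hf : ContDiff ℝ 1 f) (p : ℝ × ℝ) :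
    partialD 0 (inX (volterra k) f) p
      = c p.1 * inX (volterra k) f p + inX (volterra l) (partialD 0 f) p := by
  rw [partialD_zero]
  exact (h.hasDerivAt_inX_volterra_fst hf p).deriv

theorem partialD_one_inX (hk : Continuous (Function.uncurry k))
    {f : ℝ × ℝ → ℝ} (hf : ContDiff ℝ 1 f) (p : ℝ × ℝ) :
    partialD 1 (inX (volterra k) f) p = inX (volterra k) (partialD 1 f) p := by
  rw [partialD_one]
  exact (hasDerivAt_inX_volterra_snd hk hf p).deriv

theorem partialD_one_eq_swap (f : ℝ × ℝ → ℝ) (p : ℝ × ℝ) :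
    partialD 1 f p = partialD 0 (fun q => f q.swap) p.swap := by
  rw [partialD_one, partialD_zero]
  rfl

theorem partialD_zero_eq_swap (f : ℝ × ℝ → ℝ) (p : ℝ × ℝ) :
    partialD 0 f p = partialD 1 (fun q => f q.swap) p.swap := by
  rw [partialD_one, partialD_zero]
  rfl

theorem contDiff_comp_swap {n : ℕ} {f : ℝ × ℝ → ℝ} (hf : ContDiff ℝ n f) :
    ContDiff ℝ n fun q : ℝ × ℝ => f q.swap :=
  hf.comp (contDiff_snd.prodMk contDiff_fst)

theorem IsDarbouxPair.partialD_one_inY (h : IsDarbouxPair c b k l kt lt)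
    {f : ℝ × ℝ → ℝ} (hf : ContDiff ℝ 1 f) (p : ℝ × ℝ) :
    partialD 1 (inY (volterra k) f) p
      = c p.2 * inY (volterra k) f p + inY (volterra l) (partialD 1 f) p := by
  rw [partialD_one_eq_swap, funext (partialD_one_eq_swap f)]
  exact h.partialD_zero_inX (contDiff_comp_swap (n := 1) (by simpa using hf)) p.swap

theorem partialD_zero_inY (hk : Continuous (Function.uncurry k))
    {f : ℝ × ℝ → ℝ} (hf : ContDiff ℝ 1 f) (p : ℝ × ℝ) :
    partialD 0 (inY (volterra k) f) p = inY (volterra k) (partialD 0 f) p := by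
  rw [partialD_zero_eq_swap, funext (partialD_zero_eq_swap f)]
  exact partialD_one_inX hk (contDiff_comp_swap (n := 1) (by simpa using hf)) p.swap

end darboux

theorem partialD_comm {f : ℝ × ℝ → ℝ} (hf : ContDiff ℝ 2 f) (i j : Fin 2) (p : ℝ × ℝ) :
    partialD i (partialD j f) p = partialD j (partialD i f) p := by
  have hd : Differentiable ℝ f := hf.differentiable (by simp)
  have h1 : ContDiff ℝ 1 (fderiv ℝ f) := hf.fderiv_right (by norm_num)
  have key : ∀ i j : Fin 2, partialD i (partialD j f) p
      = fderiv ℝ (fderiv ℝ f) p (if i = 0 then (1, 0) else (0, 1))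
        (if j = 0 then (1, 0) else (0, 1)) := by
    intro i j
    rw [funext fun q => partialD_eq_fderiv (hd q) j]
    have h2 : DifferentiableAt ℝ (fderiv ℝ f) p := h1.differentiable (by simp) p
    rw [partialD_eq_fderiv (h2.clm_apply (differentiableAt_const _)),
      fderiv_clm_apply h2 (differentiableAt_const _)]
    simp
  rw [key, key]
  exact (hf.contDiffAt.isSymmSndFDerivAt (by simp)).eq _ _

/-- The Volterra operators with kernels `k`, `m` acting in the first and second variable. -/
def planeVolterra (k m : ℝ → ℝ → ℝ) (f : ℝ × ℝ → ℝ) : ℝ × ℝ → ℝ :=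
  inX (volterra k) (inY (volterra m) f)

theorem inX_volterra_add {k : ℝ → ℝ → ℝ} (hk : Continuous (Function.uncurry k))
    {f g : ℝ × ℝ → ℝ} (hf : Continuous f) (hg : Continuous g) (p : ℝ × ℝ) :
    inX (volterra k) (fun q => f q + g q) p = inX (volterra k) f p + inX (volterra k) g p := by
  have ck : Continuous fun t => k p.1 t := hk.comp (by fun_prop : Continuous fun t => (p.1, t))
  have e : ∫ t in (-p.1)..p.1, k p.1 t * (f (t, p.2) + g (t, p.2))
      = (∫ t in (-p.1)..p.1, k p.1 t * f (t, p.2))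
        + ∫ t in (-p.1)..p.1, k p.1 t * g (t, p.2) := by
    rw [← intervalIntegral.integral_add]
    · exact integral_congr fun t _ => by ring
    · exact (ck.mul (by fun_prop)).intervalIntegrable _ _
    · exact (ck.mul (by fun_prop)).intervalIntegrable _ _
  simp only [inX, volterra]
  rw [e]
  ring

theorem inX_volterra_mul_snd (k : ℝ → ℝ → ℝ) (c : ℝ → ℝ) (f : ℝ × ℝ → ℝ) (p : ℝ × ℝ) :
    inX (volterra k) (fun q => c q.2 * f q) p = c p.2 * inX (volterra k) f p := by
  simp only [inX, volterra, mul_add, ← intervalIntegral.integral_const_mul]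
  congr 1
  exact integral_congr fun t _ => by ring

theorem inY_volterra_add {k : ℝ → ℝ → ℝ} (hk : Continuous (Function.uncurry k))
    {f g : ℝ × ℝ → ℝ} (hf : Continuous f) (hg : Continuous g) (p : ℝ × ℝ) :
    inY (volterra k) (fun q => f q + g q) p = inY (volterra k) f p + inY (volterra k) g p :=
  inX_volterra_add hk (hf.comp continuous_swap) (hg.comp continuous_swap) p.swap

theorem planeVolterra_add {k m : ℝ → ℝ → ℝ} (hk : Continuous (Function.uncurry k))
    (hm : Continuous (Function.uncurry m)) {f g : ℝ × ℝ → ℝ} (hf : Continuous f)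
    (hg : Continuous g) (p : ℝ × ℝ) :
    planeVolterra k m (fun q => f q + g q) p = planeVolterra k m f p + planeVolterra k m g p := by
  rw [planeVolterra, funext (inY_volterra_add hm hf hg),
    inX_volterra_add hk (continuous_inY_volterra hm hf) (continuous_inY_volterra hm hg)]
  rfl

section plane

variable {c₁ c₂ : ℝ → ℝ} {b₁ b₂ : ℝ} {k₁ l₁ kt₁ lt₁ k₂ l₂ kt₂ lt₂ : ℝ → ℝ → ℝ}

theorem contDiff_two_planeVolterra (h₁ : IsDarbouxPair c₁ b₁ k₁ l₁ kt₁ lt₁)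
    (h₂ : IsDarbouxPair c₂ b₂ k₂ l₂ kt₂ lt₂) (hc₁ : ContDiff ℝ 1 c₁) (hc₂ : ContDiff ℝ 1 c₂)
    {f : ℝ × ℝ → ℝ} (hf : ContDiff ℝ 2 f) : ContDiff ℝ 2 (planeVolterra k₁ k₂ f) :=
  h₁.contDiff_two_inX hc₁ (h₂.contDiff_two_inY hc₂ hf)

theorem IsDarbouxPair.contDiff_one_inY (h : IsDarbouxPair c₁ b₁ k₁ l₁ kt₁ lt₁) {f : ℝ × ℝ → ℝ}
    (hf : ContDiff ℝ 1 f) : ContDiff ℝ 1 (inY (volterra k₁) f) :=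
  (h.contDiff_one_inX (hf.comp (contDiff_snd.prodMk contDiff_fst))).comp
    (contDiff_snd.prodMk contDiff_fst)

theorem partialD_zero_planeVolterra (h₁ : IsDarbouxPair c₁ b₁ k₁ l₁ kt₁ lt₁)
    (h₂ : IsDarbouxPair c₂ b₂ k₂ l₂ kt₂ lt₂) {f : ℝ × ℝ → ℝ} (hf : ContDiff ℝ 1 f)
    (p : ℝ × ℝ) :
    partialD 0 (planeVolterra k₁ k₂ f) p
      = c₁ p.1 * planeVolterra k₁ k₂ f p + planeVolterra l₁ k₂ (partialD 0 f) p := by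
  rw [planeVolterra, h₁.partialD_zero_inX (h₂.contDiff_one_inY hf),
    funext (partialD_zero_inY h₂.cont_k hf)]
  rfl

/-- The factor c₂(x₂) is constant for the integration in x₁, so it passes through the outer
operator. -/
theorem partialD_one_planeVolterra (h₁ : IsDarbouxPair c₁ b₁ k₁ l₁ kt₁ lt₁)
    (h₂ : IsDarbouxPair c₂ b₂ k₂ l₂ kt₂ lt₂) {f : ℝ × ℝ → ℝ} (hf : ContDiff ℝ 1 f)
    (p : ℝ × ℝ) :
    partialD 1 (planeVolterra k₁ k₂ f) p
      = c₂ p.2 * planeVolterra k₁ k₂ f p + planeVolterra k₁ l₂ (partialD 1 f) p := by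
  have cf := (contDiff_partialD (n := 0) (by simpa using hf) 1).continuous
  have hc := h₂.cont_c
  have cT := continuous_inY_volterra h₂.cont_k hf.continuous
  rw [planeVolterra, partialD_one_inX h₁.cont_k (h₂.contDiff_one_inY hf),
    funext (h₂.partialD_one_inY hf),
    inX_volterra_add h₁.cont_k (by fun_prop) (continuous_inY_volterra h₂.cont_l cf),
    inX_volterra_mul_snd]
  rfl

end plane

/-! ### The supercharges acting on transmuted functions -/

theorem partialD_zero_separable (χ₁ χ₂ : ℝ → ℝ) (p : ℝ × ℝ) :
    partialD 0 (fun q : ℝ × ℝ => χ₁ q.1 + χ₂ q.2) p = deriv χ₁ p.1 := by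
  rw [partialD_zero]
  simp

theorem partialD_one_separable (χ₁ χ₂ : ℝ → ℝ) (p : ℝ × ℝ) :
    partialD 1 (fun q : ℝ × ℝ => χ₁ q.1 + χ₂ q.2) p = deriv χ₂ p.2 := by
  rw [partialD_one]
  simp

theorem partialD_neg (i : Fin 2) (f : ℝ × ℝ → ℝ) (p : ℝ × ℝ) :
    partialD i (fun q => -f q) p = -partialD i f p := by
  fin_cases i
  · exact (partialD_zero _ p).trans
      ((deriv.fun_neg (f := fun s => f (s, p.2))).trans (by rw [← partialD_zero]; rfl))
  · exact (partialD_one _ p).trans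
      ((deriv.fun_neg (f := fun s => f (p.1, s))).trans (by rw [← partialD_one]; rfl))

theorem qMinus_neg (χ : ℝ × ℝ → ℝ) (i : Fin 2) (f : ℝ × ℝ → ℝ) :
    qMinus χ i (fun q => -f q) = fun p => -qMinus χ i f p := by
  funext p
  rw [qMinus, partialD_neg, qMinus]
  ring

theorem qPlus_neg (χ : ℝ × ℝ → ℝ) (i : Fin 2) (f : ℝ × ℝ → ℝ) :
    qPlus χ i (fun q => -f q) = fun p => -qPlus χ i f p := by
  funext p
  rw [qPlus, partialD_neg, qPlus]
  ring

theorem pPlus_zero (χ f : ℝ × ℝ → ℝ) : pPlus χ 0 f = qMinus χ 1 f := by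
  funext p
  simp [pPlus, eps]

theorem pPlus_one (χ f : ℝ × ℝ → ℝ) : pPlus χ 1 f = fun p => -qMinus χ 0 f p := by
  funext p
  simp [pPlus, eps]

theorem pMinus_zero (χ f : ℝ × ℝ → ℝ) : pMinus χ 0 f = qPlus χ 1 f := by
  funext p
  simp [pMinus, eps]

theorem pMinus_one (χ f : ℝ × ℝ → ℝ) : pMinus χ 1 f = fun p => -qPlus χ 0 f p := by
  funext p
  simp [pMinus, eps]

section supercharges

variable {χ₁ χ₂ : ℝ → ℝ} {χ : ℝ × ℝ → ℝ} {c₁ c₂ : ℝ → ℝ} {b₁ b₂ : ℝ}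
  {k₁ l₁ kt₁ lt₁ k₂ l₂ kt₂ lt₂ : ℝ → ℝ → ℝ}

theorem qPlus_zero_planeVolterra (hχ : ∀ p, χ p = χ₁ p.1 + χ₂ p.2)
    (h₁ : IsDarbouxPair (deriv χ₁) b₁ k₁ l₁ kt₁ lt₁) (h₂ : IsDarbouxPair c₂ b₂ k₂ l₂ kt₂ lt₂)
    {f : ℝ × ℝ → ℝ} (hf : ContDiff ℝ 1 f) :
    qPlus χ 0 (planeVolterra k₁ k₂ f) = fun p => -planeVolterra l₁ k₂ (partialD 0 f) p := by
  funext p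
  rw [qPlus, funext hχ, partialD_zero_separable, partialD_zero_planeVolterra h₁ h₂ hf]
  ring

theorem qMinus_zero_planeVolterra (hχ : ∀ p, χ p = χ₁ p.1 + χ₂ p.2)
    (h₁ : IsDarbouxPair (deriv χ₁) b₁ k₁ l₁ kt₁ lt₁) (h₂ : IsDarbouxPair c₂ b₂ k₂ l₂ kt₂ lt₂)
    {f : ℝ × ℝ → ℝ} (hf : ContDiff ℝ 1 f) :
    qMinus χ 0 (planeVolterra l₁ k₂ f) = planeVolterra k₁ k₂ (partialD 0 f) := by
  funext p
  rw [qMinus, funext hχ, partialD_zero_separable, partialD_zero_planeVolterra h₁.symm h₂ hf]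
  ring

theorem qPlus_one_planeVolterra (hχ : ∀ p, χ p = χ₁ p.1 + χ₂ p.2)
    (h₁ : IsDarbouxPair c₁ b₁ k₁ l₁ kt₁ lt₁) (h₂ : IsDarbouxPair (deriv χ₂) b₂ k₂ l₂ kt₂ lt₂)
    {f : ℝ × ℝ → ℝ} (hf : ContDiff ℝ 1 f) :
    qPlus χ 1 (planeVolterra k₁ k₂ f) = fun p => -planeVolterra k₁ l₂ (partialD 1 f) p := by
  funext p
  rw [qPlus, funext hχ, partialD_one_separable, partialD_one_planeVolterra h₁ h₂ hf]
  ring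

theorem qMinus_one_planeVolterra (hχ : ∀ p, χ p = χ₁ p.1 + χ₂ p.2)
    (h₁ : IsDarbouxPair c₁ b₁ k₁ l₁ kt₁ lt₁) (h₂ : IsDarbouxPair (deriv χ₂) b₂ k₂ l₂ kt₂ lt₂)
    {f : ℝ × ℝ → ℝ} (hf : ContDiff ℝ 1 f) :
    qMinus χ 1 (planeVolterra k₁ l₂ f) = planeVolterra k₁ k₂ (partialD 1 f) := by
  funext p
  rw [qMinus, funext hχ, partialD_one_separable, partialD_one_planeVolterra h₁ h₂.symm hf]
  ring

theorem planeVolterra_laplace (hk : Continuous (Function.uncurry k₁))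
    (hm : Continuous (Function.uncurry k₂)) {f : ℝ × ℝ → ℝ} (hf : ContDiff ℝ 2 f) (p : ℝ × ℝ) :
    planeVolterra k₁ k₂ (laplace f) p = planeVolterra k₁ k₂ (partialD 0 (partialD 0 f)) p
      + planeVolterra k₁ k₂ (partialD 1 (partialD 1 f)) p := by
  have c (i) : Continuous (partialD i (partialD i f)) :=
    (contDiff_partialD (n := 0) (by
      simpa using contDiff_partialD (n := 1) (hf.of_le (by norm_num)) i) i).continuous
  rw [← planeVolterra_add hk hm (c 0) (c 1)]
  congr 1
  funext q
  simp [laplace]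

variable (hχ : ∀ p, χ p = χ₁ p.1 + χ₂ p.2)
    (h₁ : IsDarbouxPair (deriv χ₁) b₁ k₁ l₁ kt₁ lt₁)
    (h₂ : IsDarbouxPair (deriv χ₂) b₂ k₂ l₂ kt₂ lt₂)
    {u v : ℝ × ℝ → ℝ} (hu : ContDiff ℝ 2 u) (hv : ContDiff ℝ 2 v) (p : ℝ × ℝ)

theorem contDiff_one_partialD_of_two {f : ℝ × ℝ → ℝ} (hf : ContDiff ℝ 2 f) (i : Fin 2) :
    ContDiff ℝ 1 (partialD i f) := contDiff_partialD (n := 1) (hf.of_le (by norm_num)) i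

include hχ h₁ h₂ hv in
-- In each variable `qMinus` turns l into k and `qPlus` turns it back, so the k-th summand is minus
-- the transmuted ∂_k² v.
theorem H0_planeVolterra :
    H0 χ (planeVolterra l₁ l₂ v) p = -planeVolterra l₁ l₂ (laplace v) p := by
  have h1 : ContDiff ℝ 1 v := hv.of_le (by norm_num)
  have h2 := contDiff_one_partialD_of_two hv
  rw [planeVolterra_laplace h₁.cont_l h₂.cont_l hv, H0, Fin.sum_univ_two,
    qMinus_zero_planeVolterra hχ h₁ h₂.symm h1, qPlus_zero_planeVolterra hχ h₁ h₂.symm (h2 0),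
    qMinus_one_planeVolterra hχ h₁.symm h₂ h1, qPlus_one_planeVolterra hχ h₁.symm h₂ (h2 1)]
  ring

include hχ h₁ h₂ hu in
theorem H2_planeVolterra :
    H2 χ (planeVolterra k₁ k₂ u) p = -planeVolterra k₁ k₂ (laplace u) p := by
  have h1 : ContDiff ℝ 1 u := hu.of_le (by norm_num)
  have h2 := contDiff_one_partialD_of_two hu
  rw [planeVolterra_laplace h₁.cont_k h₂.cont_k hu, H2, Fin.sum_univ_two, pMinus_zero, pMinus_one,
    pPlus_zero, pPlus_one, qMinus_neg,
    qPlus_zero_planeVolterra hχ h₁ h₂ h1, qPlus_one_planeVolterra hχ h₁ h₂ h1, qMinus_neg,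
    qMinus_neg, qMinus_zero_planeVolterra hχ h₁ h₂ (h2 0),
    qMinus_one_planeVolterra hχ h₁ h₂ (h2 1)]
  ring

include hχ h₁ h₂ hu hv in
-- The diagonal entry gives both second derivatives of v. In the off-diagonal entry the q-part and
-- the p-part are the transmuted mixed derivatives of u with opposite signs, and they cancel.
theorem H1_planeVolterra_zero :
    H1 χ ![planeVolterra k₁ l₂ v, planeVolterra l₁ k₂ u] 0 p
      = -planeVolterra k₁ l₂ (laplace v) p := by
  have hv1 : ContDiff ℝ 1 v := hv.of_le (by norm_num)
  have hv2 := contDiff_one_partialD_of_two hv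
  have hu1 : ContDiff ℝ 1 u := hu.of_le (by norm_num)
  have hu2 := contDiff_one_partialD_of_two hu
  rw [planeVolterra_laplace h₁.cont_k h₂.cont_l hv, H1, Fin.sum_univ_two, H1entry, H1entry]
  simp only [Matrix.cons_val_zero, Matrix.cons_val_one]
  rw [pPlus_zero, pPlus_one, pMinus_zero, pMinus_zero, qPlus_neg,
    qPlus_zero_planeVolterra hχ h₁ h₂.symm hv1, qMinus_neg,
    qMinus_zero_planeVolterra hχ h₁ h₂.symm (hv2 0),
    qMinus_one_planeVolterra hχ h₁ h₂ hv1, qPlus_one_planeVolterra hχ h₁ h₂ (hv2 1),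
    qPlus_one_planeVolterra hχ h₁.symm h₂ hu1, qMinus_neg,
    qMinus_zero_planeVolterra hχ h₁ h₂.symm (hu2 1),
    qMinus_zero_planeVolterra hχ h₁ h₂ hu1, qPlus_one_planeVolterra hχ h₁ h₂ (hu2 0),
    funext (partialD_comm hu 0 1)]
  ring

include hχ h₁ h₂ hu hv in
theorem H1_planeVolterra_one :
    H1 χ ![planeVolterra k₁ l₂ v, planeVolterra l₁ k₂ u] 1 p
      = -planeVolterra l₁ k₂ (laplace u) p := by
  have hv1 : ContDiff ℝ 1 v := hv.of_le (by norm_num)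
  have hv2 := contDiff_one_partialD_of_two hv
  have hu1 : ContDiff ℝ 1 u := hu.of_le (by norm_num)
  have hu2 := contDiff_one_partialD_of_two hu
  rw [planeVolterra_laplace h₁.cont_l h₂.cont_k hu, H1, Fin.sum_univ_two, H1entry, H1entry]
  simp only [Matrix.cons_val_zero, Matrix.cons_val_one]
  rw [pPlus_zero, pPlus_one, pMinus_one, pMinus_one, qPlus_neg,
    qPlus_zero_planeVolterra hχ h₁ h₂.symm hv1, qMinus_neg,
    qMinus_one_planeVolterra hχ h₁.symm h₂ (hv2 0),
    qMinus_one_planeVolterra hχ h₁ h₂ hv1, qPlus_zero_planeVolterra hχ h₁ h₂ (hv2 1),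
    qPlus_one_planeVolterra hχ h₁.symm h₂ hu1, qMinus_neg,
    qMinus_one_planeVolterra hχ h₁.symm h₂ (hu2 1),
    qMinus_zero_planeVolterra hχ h₁ h₂ hu1, qPlus_zero_planeVolterra hχ h₁ h₂ (hu2 0),
    funext (partialD_comm hv 0 1)]
  ring

end supercharges

/-! ### The Goursat problem as an integral equation -/

theorem abs_integral_le_exp {l : ℝ} (hl : 0 < l) {φ : ℝ → ℝ} {C u : ℝ} (hC : 0 ≤ C)
    (h : ∀ α ∈ uIoc 0 u, |φ α| ≤ C * Real.exp (l * |α|)) :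
    |∫ α in (0 : ℝ)..u, φ α| ≤ C * Real.exp (l * |u|) / l := by
  have pos : ∀ y : ℝ, 0 ≤ y →
      |∫ α in (0 : ℝ)..y, C * Real.exp (l * |α|)| ≤ C * Real.exp (l * |y|) / l := by
    intro y hy
    have e : ∫ α in (0 : ℝ)..y, C * Real.exp (l * |α|)
        = C * Real.exp (l * y) / l - C * Real.exp (l * 0) / l := by
      refine integral_eq_sub_of_hasDerivAt (f := fun α => C * Real.exp (l * α) / l) ?_ ?_
      · intro α hα
        rw [uIcc_of_le hy] at hα
        rw [abs_of_nonneg hα.1]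
        have := (((hasDerivAt_id α).const_mul l).exp.const_mul C).div_const l
        refine this.congr_deriv ?_
        simp only [id]
        field_simp
      · exact Continuous.intervalIntegrable (by fun_prop) _ _
    rw [e, abs_of_nonneg hy, abs_of_nonneg]
    · simp only [mul_zero, Real.exp_zero, mul_one]
      have : 0 ≤ C / l := by positivity
      linarith
    · rw [sub_nonneg]
      gcongr
  have hcont : IntervalIntegrable (fun α => C * Real.exp (l * |α|)) volume 0 u :=
    Continuous.intervalIntegrable (by fun_prop) _ _
  have hle := intervalIntegral.norm_integral_le_abs_of_norm_le (f := φ)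
    ((ae_restrict_iff' measurableSet_uIoc).2 (Eventually.of_forall h)) hcont
  refine hle.trans ?_
  rcases le_total 0 u with hu | hu
  · exact pos u hu
  · have := pos (-u) (by linarith)
    have e := intervalIntegral.integral_comp_neg (a := 0) (b := u)
      (fun α => C * Real.exp (l * |α|))
    simp only [abs_neg, neg_zero] at e this
    rw [e, intervalIntegral.integral_symm, abs_neg]
    exact this

/-- Each integration of the exponential weight gains a factor 1/l. For l large, the Goursat operator
therefore contracts in the weighted sup norm, whatever the bound on q. -/
theorem abs_integral_integral_le_exp {l : ℝ} (hl : 0 < l) {φ : ℝ → ℝ → ℝ} {C u v : ℝ}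
    (hC : 0 ≤ C)
    (h : ∀ α ∈ uIoc 0 u, ∀ β ∈ uIoc 0 v, |φ α β| ≤ C * Real.exp (l * (|α| + |β|))) :
    |∫ β in (0 : ℝ)..v, ∫ α in (0 : ℝ)..u, φ α β|
      ≤ C / l ^ 2 * Real.exp (l * (|u| + |v|)) := by
  have h1 : ∀ β ∈ uIoc 0 v, |∫ α in (0 : ℝ)..u, φ α β|
      ≤ C * Real.exp (l * |u|) / l * Real.exp (l * |β|) := by
    intro β hβ
    refine (abs_integral_le_exp hl (C := C * Real.exp (l * |β|)) (by positivity)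
      fun α hα => (h α hα β hβ).trans (le_of_eq ?_)).trans (le_of_eq ?_)
    · rw [mul_add, Real.exp_add]; ring
    · ring
  refine (abs_integral_le_exp hl (by positivity) h1).trans (le_of_eq ?_)
  rw [mul_add, Real.exp_add]
  field_simp

theorem uIoc_zero_abs_le {u α : ℝ} (h : α ∈ uIoc 0 u) : |α| ≤ |u| := by
  rcases le_total 0 u with hu | hu
  · rw [uIoc_of_le hu] at h
    rw [abs_of_pos h.1, abs_of_nonneg hu]
    exact h.2
  · rw [uIoc_of_ge hu] at h
    rw [abs_of_nonpos h.2, abs_of_nonpos hu]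
    linarith [h.1]

/-- Uniqueness for the homogeneous integral equation on a diamond. -/
theorem eq_zero_of_goursat_homogeneous {q : ℝ → ℝ} {d : ℝ → ℝ → ℝ} {r B : ℝ}
    (hB : ∀ s, |s| ≤ r → |q s| ≤ B)
    (hd : ContinuousOn (Function.uncurry d) {p : ℝ × ℝ | |p.1| + |p.2| ≤ r})
    (h : ∀ u v, |u| + |v| ≤ r →
      d u v = ∫ β in (0 : ℝ)..v, ∫ α in (0 : ℝ)..u, q (α + β) * d α β)
    {u v : ℝ} (huv : |u| + |v| ≤ r) : d u v = 0 := by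
  have hr : 0 ≤ r := by linarith [abs_nonneg u, abs_nonneg v]
  have hB0 : 0 ≤ B := (abs_nonneg _).trans (hB 0 (by simpa using hr))
  -- Chosen so that l² > B. The weighted maximum m then satisfies m ≤ (B / l²) m, which forces m =
  -- 0.
  set l : ℝ := 2 * B + 1 with hl
  have hl0 : 0 < l := by positivity
  have hcomp : IsCompact {p : ℝ × ℝ | |p.1| + |p.2| ≤ r} := by
    refine ((isCompact_Icc (a := -r) (b := r)).prod
      (isCompact_Icc (a := -r) (b := r))).of_isClosed_subset
      (isClosed_le (by fun_prop) continuous_const) ?_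
    intro p hp
    simp only [mem_ofPred_eq] at hp
    exact ⟨abs_le.1 (by linarith [abs_nonneg p.2]), abs_le.1 (by linarith [abs_nonneg p.1])⟩
  have hcont : ContinuousOn (fun p : ℝ × ℝ => Real.exp (-l * (|p.1| + |p.2|)) * |d p.1 p.2|)
      {p : ℝ × ℝ | |p.1| + |p.2| ≤ r} :=
    ContinuousOn.mul (by fun_prop) hd.abs
  obtain ⟨p, hp, hmax⟩ := hcomp.exists_isMaxOn ⟨(u, v), huv⟩ hcont
  simp only [mem_ofPred_eq] at hp
  set m := Real.exp (-l * (|p.1| + |p.2|)) * |d p.1 p.2| with hm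
  have hm0 : 0 ≤ m := by positivity
  have hle : ∀ α β, |α| + |β| ≤ r → |d α β| ≤ m * Real.exp (l * (|α| + |β|)) := by
    intro α β hαβ
    have h1 : Real.exp (-l * (|α| + |β|)) * |d α β| ≤ m := hmax (a := (α, β)) hαβ
    calc |d α β| = Real.exp (-l * (|α| + |β|)) * |d α β| * Real.exp (l * (|α| + |β|)) := by
          rw [mul_right_comm, ← Real.exp_add]
          simp
      _ ≤ _ := by gcongr
  have h2 : |d p.1 p.2| ≤ B * m / l ^ 2 * Real.exp (l * (|p.1| + |p.2|)) := by
    rw [h p.1 p.2 hp]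
    refine abs_integral_integral_le_exp hl0 (by positivity) fun α hα β hβ => ?_
    have ha := uIoc_zero_abs_le hα
    have hb := uIoc_zero_abs_le hβ
    rw [abs_mul, mul_assoc]
    gcongr
    · exact hB _ ((abs_add_le _ _).trans (by linarith))
    · exact hle α β (by linarith)
  have h3 : m ≤ B * m / l ^ 2 := by
    calc m ≤ Real.exp (-l * (|p.1| + |p.2|))
          * (B * m / l ^ 2 * Real.exp (l * (|p.1| + |p.2|))) := by rw [hm]; gcongr
      _ = _ := by
        rw [mul_left_comm, ← Real.exp_add]
        simp
  have h4 : m = 0 := by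
    rw [le_div_iff₀ (by positivity)] at h3
    have : l ^ 2 ≥ B + 1 := by rw [hl]; nlinarith
    nlinarith
  have := hle u v huv
  rw [h4, zero_mul] at this
  exact abs_nonpos_iff.1 this

/-- The integral form of the Goursat problem in characteristic coordinates. -/
structure IsGoursatIntegral (q g : ℝ → ℝ) (W : ℝ → ℝ → ℝ) : Prop where
  cont : Continuous (Function.uncurry W)
  eq : ∀ u v, W u v = g u + ∫ β in (0 : ℝ)..v, ∫ α in (0 : ℝ)..u, q (α + β) * W α β

theorem continuous_integral_integral {φ : ℝ → ℝ → ℝ} (hφ : Continuous (Function.uncurry φ)) :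
    Continuous fun p : ℝ × ℝ => ∫ β in (0 : ℝ)..p.2, ∫ α in (0 : ℝ)..p.1, φ α β := by
  refine continuous_integral_moving
    (g := fun (p : ℝ × ℝ) β => ∫ α in (0 : ℝ)..p.1, φ α β) ?_ continuous_const continuous_snd
  exact continuous_integral_moving (g := fun (x : (ℝ × ℝ) × ℝ) α => φ α x.2)
    (hφ.comp (by fun_prop : Continuous fun y : ((ℝ × ℝ) × ℝ) × ℝ => (y.2, y.1.2)))
    continuous_const (by fun_prop)

/-- Banach's fixed point theorem for the unknown e^{-l(|u|+|v|)} W in the bounded continuous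
functions. The growth bound on g makes the weighted data bounded because l ≥ 1. -/
theorem exists_isGoursatIntegral {q g : ℝ → ℝ} (hq : Continuous q) (hg : Continuous g) {B : ℝ}
    (hB : ∀ s, |q s| ≤ B) (hgB : ∀ s, |g s| ≤ B * Real.exp |s|) :
    ∃ W, IsGoursatIntegral q g W := by
  have hB0 : 0 ≤ B := (abs_nonneg _).trans (hB 0)
  -- Here (2B + 1)² ≥ 2B gives B / l² ≤ 1/2, the contraction constant.
  set l : ℝ := 2 * B + 1 with hl
  have hl1 : 1 ≤ l := by linarith
  have hl0 : 0 < l := by positivity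
  have hlB : B / l ^ 2 ≤ 1 / 2 := by
    rw [div_le_iff₀ (by positivity), hl]
    nlinarith
  let I : BoundedContinuousFunction (ℝ × ℝ) ℝ → ℝ × ℝ → ℝ := fun w p =>
    ∫ β in (0 : ℝ)..p.2, ∫ α in (0 : ℝ)..p.1,
      q (α + β) * (Real.exp (l * (|α| + |β|)) * w (α, β))
  have cφ : ∀ w : BoundedContinuousFunction (ℝ × ℝ) ℝ, Continuous (Function.uncurry
      fun α β => q (α + β) * (Real.exp (l * (|α| + |β|)) * w (α, β))) := by
    intro w
    have hw := w.continuous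
    refine Continuous.mul (f := fun p : ℝ × ℝ => q (p.1 + p.2))
      (g := fun p : ℝ × ℝ => Real.exp (l * (|p.1| + |p.2|)) * w (p.1, p.2))
      (by fun_prop) (by fun_prop)
  have cI : ∀ w, Continuous (I w) := fun w => continuous_integral_integral (cφ w)
  have bI : ∀ (w : BoundedContinuousFunction (ℝ × ℝ) ℝ) (C : ℝ), (∀ p, |w p| ≤ C) → ∀ p,
      |I w p| ≤ C / 2 * Real.exp (l * (|p.1| + |p.2|)) := by
    intro w C hC p
    have hC0 : 0 ≤ C := (abs_nonneg _).trans (hC 0)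
    refine (abs_integral_integral_le_exp (C := B * C) hl0 (by positivity)
      fun α _ β _ => ?_).trans ?_
    · rw [abs_mul, abs_mul, Real.abs_exp, mul_assoc, mul_comm C]
      gcongr
      · exact hB _
      · exact hC _
    · refine mul_le_mul_of_nonneg_right ?_ (Real.exp_pos _).le
      rw [mul_div_right_comm]
      calc B / l ^ 2 * C ≤ 1 / 2 * C := by gcongr
        _ = C / 2 := by ring
  have hexp : ∀ p : ℝ × ℝ,
      Real.exp (-l * (|p.1| + |p.2|)) * Real.exp (l * (|p.1| + |p.2|)) = 1 := by
    intro p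
    rw [← Real.exp_add]
    simp
  let F : BoundedContinuousFunction (ℝ × ℝ) ℝ → BoundedContinuousFunction (ℝ × ℝ) ℝ := fun w =>
    BoundedContinuousFunction.ofNormedAddCommGroup
      (fun p => Real.exp (-l * (|p.1| + |p.2|)) * (g p.1 + I w p))
      (by have := cI w; fun_prop) (B + ‖w‖ / 2) (by
        intro p
        rw [Real.norm_eq_abs, abs_mul, Real.abs_exp]
        have h1 : |g p.1| ≤ B * Real.exp (l * (|p.1| + |p.2|)) := by
          refine (hgB _).trans ?_
          gcongr
          nlinarith [abs_nonneg p.1, abs_nonneg p.2]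
        have h2 := bI w ‖w‖ (fun p => w.norm_coe_le_norm p) p
        calc Real.exp (-l * (|p.1| + |p.2|)) * |g p.1 + I w p|
            ≤ Real.exp (-l * (|p.1| + |p.2|)) * (B * Real.exp (l * (|p.1| + |p.2|))
              + ‖w‖ / 2 * Real.exp (l * (|p.1| + |p.2|))) := by
              gcongr
              exact (abs_add_le _ _).trans (add_le_add h1 h2)
          _ = (Real.exp (-l * (|p.1| + |p.2|)) * Real.exp (l * (|p.1| + |p.2|)))
              * (B + ‖w‖ / 2) := by ring
          _ = _ := by rw [hexp, one_mul])
  have hF : ContractingWith (1 / 2) F := by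
    refine ⟨by rw [← NNReal.coe_lt_coe]; norm_num, LipschitzWith.of_dist_le_mul fun w w' => ?_⟩
    rw [BoundedContinuousFunction.dist_le (by positivity)]
    intro p
    have hsub : I w p - I w' p = I (w - w') p := by
      have ii : ∀ (w : BoundedContinuousFunction (ℝ × ℝ) ℝ) (β : ℝ), IntervalIntegrable
          (fun α => q (α + β) * (Real.exp (l * (|α| + |β|)) * w (α, β))) volume 0 p.1 :=
        fun w β => ((cφ w).comp
          (by fun_prop : Continuous fun α : ℝ => (α, β))).intervalIntegrable _ _
      have io : ∀ w : BoundedContinuousFunction (ℝ × ℝ) ℝ, IntervalIntegrable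
          (fun β => ∫ α in (0 : ℝ)..p.1, q (α + β) * (Real.exp (l * (|α| + |β|)) * w (α, β)))
          volume 0 p.2 := fun w => (continuous_integral_moving
            (g := fun β α => q (α + β) * (Real.exp (l * (|α| + |β|)) * w (α, β)))
            ((cφ w).comp continuous_swap) continuous_const
            continuous_const).intervalIntegrable _ _
      simp only [I]
      rw [← intervalIntegral.integral_sub (io w) (io w')]
      refine integral_congr fun β _ => ?_
      refine (intervalIntegral.integral_sub (ii w β) (ii w' β)).symm.trans ?_
      refine integral_congr fun α _ => ?_
      simp only [BoundedContinuousFunction.coe_sub, Pi.sub_apply]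
      ring
    have h2 := bI (w - w') (dist w w') (fun p => by
      rw [dist_eq_norm]; exact (w - w').norm_coe_le_norm p) p
    simp only [F, BoundedContinuousFunction.coe_ofNormedAddCommGroup]
    rw [Real.dist_eq, ← mul_sub, add_sub_add_left_eq_sub, hsub, abs_mul, Real.abs_exp]
    calc Real.exp (-l * (|p.1| + |p.2|)) * |I (w - w') p|
        ≤ Real.exp (-l * (|p.1| + |p.2|))
          * (dist w w' / 2 * Real.exp (l * (|p.1| + |p.2|))) := by gcongr
      _ = (Real.exp (-l * (|p.1| + |p.2|)) * Real.exp (l * (|p.1| + |p.2|)))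
          * (dist w w' / 2) := by ring
      _ = _ := by rw [hexp]; push_cast; ring
  obtain ⟨w, hw⟩ : ∃ w, F w = w := ⟨hF.fixedPoint, hF.fixedPoint_isFixedPt⟩
  have hw' : ∀ p : ℝ × ℝ, Real.exp (l * (|p.1| + |p.2|)) * w p = g p.1 + I w p := by
    intro p
    have : Real.exp (-l * (|p.1| + |p.2|)) * (g p.1 + I w p) = w p :=
      congrArg (fun f : BoundedContinuousFunction (ℝ × ℝ) ℝ => f p) hw
    rw [← this, ← mul_assoc, mul_comm (Real.exp (l * _)), hexp, one_mul]
  refine ⟨fun u v => Real.exp (l * (|u| + |v|)) * w (u, v), ?_, fun u v => hw' (u, v)⟩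
  have := w.continuous
  exact Continuous.mul (f := fun p : ℝ × ℝ => Real.exp (l * (|p.1| + |p.2|)))
    (g := fun p : ℝ × ℝ => w (p.1, p.2)) (by fun_prop) (by fun_prop)

/-! ### First derivatives and the mixed derivative of solutions of the integral equation -/

section derivatives

variable {q g g' : ℝ → ℝ} {W : ℝ → ℝ → ℝ}

theorem IsGoursatIntegral.continuous_integrand (h : IsGoursatIntegral q g W) (hq : Continuous q) :
    Continuous fun p : ℝ × ℝ => q (p.1 + p.2) * W p.1 p.2 :=
  Continuous.mul (by fun_prop) h.cont

theorem IsGoursatIntegral.hasDerivAt_snd (h : IsGoursatIntegral q g W) (hq : Continuous q)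
    (u v : ℝ) :
    HasDerivAt (fun v => W u v) (∫ α in (0 : ℝ)..u, q (α + v) * W α v) v := by
  have hc := h.continuous_integrand hq
  rw [funext (h.eq u)]
  refine HasDerivAt.const_add _ (hasDerivAt_primitive (continuous_integral_moving
    (g := fun v α => q (α + v) * W α v) (hc.comp continuous_swap) continuous_const
    continuous_const) _ _)

theorem IsGoursatIntegral.hasDerivAt_fst (h : IsGoursatIntegral q g W) (hq : Continuous q)
    (hg : ∀ u, HasDerivAt g (g' u) u) (u v : ℝ) :
    HasDerivAt (fun u => W u v) (g' u + ∫ β in (0 : ℝ)..v, q (u + β) * W u β) u := by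
  have hc := h.continuous_integrand hq
  rw [funext fun u => h.eq u v]
  refine (hg u).add (hasDerivAt_integral_param
    (g := fun u β => ∫ α in (0 : ℝ)..u, q (α + β) * W α β)
    (g' := fun u β => q (u + β) * W u β) (fun u => continuous_integral_moving
    (g := fun v α => q (α + v) * W α v) (hc.comp continuous_swap) continuous_const
    continuous_const) hc (fun u β => hasDerivAt_primitive
      (hc.comp (by fun_prop : Continuous fun α : ℝ => (α, β))) _ _) _ _ _)

theorem IsGoursatIntegral.continuous_deriv_snd (h : IsGoursatIntegral q g W)
    (hq : Continuous q) :
    Continuous fun p : ℝ × ℝ => ∫ α in (0 : ℝ)..p.1, q (α + p.2) * W α p.2 :=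
  continuous_integral_moving (g := fun (p : ℝ × ℝ) α => q (α + p.2) * W α p.2)
    ((h.continuous_integrand hq).comp
      (by fun_prop : Continuous fun x : (ℝ × ℝ) × ℝ => (x.2, x.1.2)))
    continuous_const continuous_fst

theorem IsGoursatIntegral.continuous_deriv_fst (h : IsGoursatIntegral q g W)
    (hq : Continuous q) (hg : Continuous g') :
    Continuous fun p : ℝ × ℝ => g' p.1 + ∫ β in (0 : ℝ)..p.2, q (p.1 + β) * W p.1 β :=
  (hg.comp continuous_fst).add
    (continuous_integral_moving (g := fun (p : ℝ × ℝ) β => q (p.1 + β) * W p.1 β)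
      ((h.continuous_integrand hq).comp
        (by fun_prop : Continuous fun x : (ℝ × ℝ) × ℝ => (x.1.1, x.2)))
      continuous_const continuous_snd)

theorem IsGoursatIntegral.hasDerivAt_deriv_snd (h : IsGoursatIntegral q g W)
    (hq : Continuous q) (u v : ℝ) :
    HasDerivAt (fun u => ∫ α in (0 : ℝ)..u, q (α + v) * W α v) (q (u + v) * W u v) u :=
  hasDerivAt_primitive ((h.continuous_integrand hq).comp
    (by fun_prop : Continuous fun α : ℝ => (α, v))) _ _

end derivatives

theorem hasDerivAt_integral_integral_fst {φ : ℝ → ℝ → ℝ} (hφ : Continuous (Function.uncurry φ))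
    (u v : ℝ) :
    HasDerivAt (fun u => ∫ β in (0 : ℝ)..v, ∫ α in (0 : ℝ)..u, φ α β)
      (∫ β in (0 : ℝ)..v, φ u β) u :=
  hasDerivAt_integral_param (g := fun u β => ∫ α in (0 : ℝ)..u, φ α β) (g' := φ)
    (fun _ => continuous_integral_moving (g := fun β α => φ α β) (hφ.comp continuous_swap)
      continuous_const continuous_const) hφ (fun u β => hasDerivAt_primitive
      (hφ.comp (by fun_prop : Continuous fun α : ℝ => (α, β))) _ _) _ _ _

theorem hasDerivAt_integral_integral_snd {φ : ℝ → ℝ → ℝ} (hφ : Continuous (Function.uncurry φ))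
    (u v : ℝ) :
    HasDerivAt (fun v => ∫ β in (0 : ℝ)..v, ∫ α in (0 : ℝ)..u, φ α β)
      (∫ α in (0 : ℝ)..u, φ α v) v :=
  hasDerivAt_primitive (continuous_integral_moving (g := fun β α => φ α β)
    (hφ.comp continuous_swap) continuous_const continuous_const) _ _

theorem integral_integral_swap_zero {φ : ℝ → ℝ → ℝ} (hφ : Continuous (Function.uncurry φ))
    (u v : ℝ) :
    ∫ α in (0 : ℝ)..u, ∫ β in (0 : ℝ)..v, φ α β = ∫ β in (0 : ℝ)..v, ∫ α in (0 : ℝ)..u, φ α β :=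
  eq_of_hasDerivAt_eq (a := 0) (f := fun u => ∫ α in (0 : ℝ)..u, ∫ β in (0 : ℝ)..v, φ α β)
    (hasDerivAt_integral_integral_snd (φ := fun β α => φ α β) (hφ.comp continuous_swap) v)
    (fun u => hasDerivAt_integral_integral_fst hφ u v) (by simp) u

/-- Integration over a characteristic rectangle of a derivative in the direction along which the
potential is constant. -/
theorem integral_characteristic_flux {q : ℝ → ℝ} {w w' : ℝ → ℝ → ℝ} (hq : Continuous q)
    (hw : Continuous (Function.uncurry w)) (hw' : Continuous (Function.uncurry w'))
    (hd : ∀ x t, HasDerivAt (fun t => w x t) (w' x t) t) (u v : ℝ) :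
    ∫ α in (0 : ℝ)..u, q (α + v) * w (α + v) (α - v)
      = (∫ α in (0 : ℝ)..u, q α * w α α)
        + (∫ β in (0 : ℝ)..v, (q (u + β) * w (u + β) (u - β) - q β * w β (-β)))
        - 2 * ∫ β in (0 : ℝ)..v, ∫ α in (0 : ℝ)..u, q (α + β) * w' (α + β) (α - β) := by
  -- After s = α + v the argument of q no longer contains v, so the integral can be differentiated
  -- in v although q is only continuous.
  have shift : ∀ (w : ℝ → ℝ → ℝ) (v : ℝ), ∫ α in (0 : ℝ)..u, q (α + v) * w (α + v) (α - v)
      = ∫ s in v..(u + v), q s * w s (s - 2 * v) := by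
    intro w v
    have := intervalIntegral.integral_comp_add_right (a := 0) (b := u)
      (fun s => q s * w s (s - 2 * v)) v
    rw [zero_add] at this
    rw [← this]
    exact integral_congr fun α _ => by ring_nf
  have c' : Continuous fun p : ℝ × ℝ => q (p.1 + p.2) * w' (p.1 + p.2) (p.1 - p.2) :=
    Continuous.mul (by fun_prop)
      (hw'.comp (by fun_prop : Continuous fun p : ℝ × ℝ => (p.1 + p.2, p.1 - p.2)))
  have d1 : ∀ v, HasDerivAt (fun v => ∫ α in (0 : ℝ)..u, q (α + v) * w (α + v) (α - v))
      (q (u + v) * w (u + v) (u - v) - q v * w v (-v)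
        - 2 * ∫ α in (0 : ℝ)..u, q (α + v) * w' (α + v) (α - v)) v := by
    intro v
    rw [funext (shift w), shift w' v]
    have := hasDerivAt_integral_moving (g := fun v s => q s * w s (s - 2 * v))
      (g' := fun v s => q s * (w' s (s - 2 * v) * (-2))) (a := fun v => v) (b := fun v => u + v)
      (x := v)
      (Continuous.mul (f := fun p : ℝ × ℝ => q p.2) (by fun_prop)
        (hw.comp (by fun_prop : Continuous fun p : ℝ × ℝ => (p.2, p.2 - 2 * p.1))))
      (Continuous.mul (f := fun p : ℝ × ℝ => q p.2) (by fun_prop)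
        ((hw'.comp (by fun_prop : Continuous fun p : ℝ × ℝ => (p.2, p.2 - 2 * p.1))).mul
          continuous_const))
      (fun v s => HasDerivAt.const_mul _ (HasDerivAt.comp (h₂ := fun t => w s t) v (hd s _)
        ((((hasDerivAt_id v).const_mul 2).const_sub s).congr_deriv (by ring))))
      (hasDerivAt_id v) ((hasDerivAt_id v).const_add u)
    refine this.congr_deriv ?_
    rw [← intervalIntegral.integral_const_mul, show u + v - 2 * v = u - v by ring,
      show v - 2 * v = -v by ring, one_mul, one_mul, sub_eq_add_neg _ (∫ _ in _.._, _),
      ← intervalIntegral.integral_neg]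
    congr 1
    exact integral_congr fun s _ => by ring
  have cb : Continuous fun β => q (u + β) * w (u + β) (u - β) - q β * w β (-β) :=
    Continuous.sub (Continuous.mul (by fun_prop)
      (hw.comp (by fun_prop : Continuous fun β : ℝ => (u + β, u - β))))
      (Continuous.mul (by fun_prop) (hw.comp (by fun_prop : Continuous fun β : ℝ => (β, -β))))
  have d2 : ∀ v, HasDerivAt (fun v => (∫ α in (0 : ℝ)..u, q α * w α α)
        + (∫ β in (0 : ℝ)..v, (q (u + β) * w (u + β) (u - β) - q β * w β (-β)))
        - 2 * ∫ β in (0 : ℝ)..v, ∫ α in (0 : ℝ)..u, q (α + β) * w' (α + β) (α - β))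
      (q (u + v) * w (u + v) (u - v) - q v * w v (-v)
        - 2 * ∫ α in (0 : ℝ)..u, q (α + v) * w' (α + v) (α - v)) v := fun v =>
    ((hasDerivAt_primitive cb 0 v).const_add _).sub
      ((hasDerivAt_integral_integral_snd (φ := fun α β => q (α + β) * w' (α + β) (α - β))
        c' u v).const_mul 2)
  exact eq_of_hasDerivAt_eq d1 d2 (a := 0) (by simp) v

/-! ### Shifting the Goursat data by a constant -/

section oddPart

variable {q : ℝ → ℝ} {W : ℝ → ℝ → ℝ}

/-- The integral `∫_{u-v}^{u+v} (K(x,s) - K(x,-s)) ds`, `x = u + v`, for `K(x,t)` given as a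
function `W` of the characteristic coordinates. -/
def oddPrimitive (W : ℝ → ℝ → ℝ) (x t : ℝ) : ℝ :=
  ∫ s in t..x, (W ((x + s) / 2) ((x - s) / 2) - W ((x - s) / 2) ((x + s) / 2))

theorem continuous_odd (hW : Continuous (Function.uncurry W)) : Continuous fun p : ℝ × ℝ =>
    W ((p.1 + p.2) / 2) ((p.1 - p.2) / 2) - W ((p.1 - p.2) / 2) ((p.1 + p.2) / 2) :=
  (hW.comp (by fun_prop : Continuous fun p : ℝ × ℝ => ((p.1 + p.2) / 2, (p.1 - p.2) / 2))).sub
    (hW.comp (by fun_prop : Continuous fun p : ℝ × ℝ => ((p.1 - p.2) / 2, (p.1 + p.2) / 2)))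

theorem continuous_oddPrimitive (hW : Continuous (Function.uncurry W)) :
    Continuous (Function.uncurry (oddPrimitive W)) :=
  continuous_integral_moving (g := fun (p : ℝ × ℝ) s =>
    W ((p.1 + s) / 2) ((p.1 - s) / 2) - W ((p.1 - s) / 2) ((p.1 + s) / 2))
    ((continuous_odd hW).comp (by fun_prop : Continuous fun x : (ℝ × ℝ) × ℝ => (x.1.1, x.2)))
    continuous_snd continuous_fst

theorem hasDerivAt_oddPrimitive (hW : Continuous (Function.uncurry W)) (x t : ℝ) :
    HasDerivAt (fun t => oddPrimitive W x t)
      (-(W ((x + t) / 2) ((x - t) / 2) - W ((x - t) / 2) ((x + t) / 2))) t := by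
  have c : Continuous fun s =>
      W ((x + s) / 2) ((x - s) / 2) - W ((x - s) / 2) ((x + s) / 2) :=
    (continuous_odd hW).comp (by fun_prop : Continuous fun s : ℝ => (x, s))
  simp only [oddPrimitive, fun t => intervalIntegral.integral_symm (f := fun s =>
      W ((x + s) / 2) ((x - s) / 2) - W ((x - s) / 2) ((x + s) / 2)) (μ := volume) x t]
  exact (hasDerivAt_primitive c x t).neg

theorem oddPrimitive_diag (x : ℝ) : oddPrimitive W x x = 0 := integral_same

theorem oddPrimitive_antidiag (x : ℝ) : oddPrimitive W x (-x) = 0 := by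
  have h := intervalIntegral.integral_comp_neg (a := -x) (b := x)
    (fun s => W ((x + s) / 2) ((x - s) / 2) - W ((x - s) / 2) ((x + s) / 2))
  simp only [neg_neg, ← sub_eq_add_neg, sub_neg_eq_add] at h
  have h' : ∫ s in (-x)..x, (W ((x - s) / 2) ((x + s) / 2) - W ((x + s) / 2) ((x - s) / 2))
      = -oddPrimitive W x (-x) := by
    rw [oddPrimitive, ← intervalIntegral.integral_neg]
    exact integral_congr fun s _ => by ring
  rw [h'] at h
  change -_ = oddPrimitive W x (-x) at h
  linarith

variable {H : ℝ → ℝ → ℝ}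

/-- Exchanging u and v is the reflection t ↦ -t, and q(u + v) is invariant under it; so the part of
K odd in t solves the equation with antisymmetrized data. -/
theorem IsGoursatIntegral.odd_eq (hq : Continuous q)
    (hH : IsGoursatIntegral q (fun u => 1 / 2 * ∫ s in (0 : ℝ)..u, q s) H) (u v : ℝ) :
    H u v - H v u = 1 / 2 * (∫ s in (0 : ℝ)..u, q s) - 1 / 2 * (∫ s in (0 : ℝ)..v, q s)
      + ∫ β in (0 : ℝ)..v, ∫ α in (0 : ℝ)..u, q (α + β) * (H α β - H β α) := by
  have c := hH.continuous_integrand hq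
  have c2 : Continuous fun p : ℝ × ℝ => q (p.1 + p.2) * H p.2 p.1 :=
    Continuous.mul (by fun_prop) (hH.cont.comp continuous_swap)
  have e1 : H v u = 1 / 2 * (∫ s in (0 : ℝ)..v, q s)
      + ∫ β in (0 : ℝ)..v, ∫ α in (0 : ℝ)..u, q (α + β) * H β α := by
    rw [← integral_integral_swap_zero (φ := fun α β => q (α + β) * H β α) c2, hH.eq v u]
    congr 1
    exact integral_congr fun s _ => integral_congr fun s' _ => by simp only [add_comm]
  have i1 : ∀ {φ : ℝ → ℝ → ℝ}, Continuous (Function.uncurry φ) → ∀ β,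
      IntervalIntegrable (fun α => φ α β) volume 0 u := fun h β =>
    (h.comp (by fun_prop : Continuous fun α : ℝ => (α, β))).intervalIntegrable _ _
  have i2 : ∀ {φ : ℝ → ℝ → ℝ}, Continuous (Function.uncurry φ) →
      IntervalIntegrable (fun β => ∫ α in (0 : ℝ)..u, φ α β) volume 0 v := fun {φ} h =>
    (continuous_integral_moving (g := fun β α => φ α β) (h.comp continuous_swap)
      continuous_const continuous_const).intervalIntegrable _ _
  have e2 : ∫ β in (0 : ℝ)..v, ∫ α in (0 : ℝ)..u, q (α + β) * (H α β - H β α)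
      = (∫ β in (0 : ℝ)..v, ∫ α in (0 : ℝ)..u, q (α + β) * H α β)
        - ∫ β in (0 : ℝ)..v, ∫ α in (0 : ℝ)..u, q (α + β) * H β α := by
    rw [← intervalIntegral.integral_sub (i2 (φ := fun α β => q (α + β) * H α β) c)
      (i2 (φ := fun α β => q (α + β) * H β α) c2)]
    refine integral_congr fun β _ => Eq.trans ?_ (intervalIntegral.integral_sub
      (i1 (φ := fun α β => q (α + β) * H α β) c β)
      (i1 (φ := fun α β => q (α + β) * H β α) c2 β))
    exact integral_congr fun α _ => by ring
  rw [e2, e1, hH.eq u v]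
  ring

/-- Formally 1 + J, with J the odd primitive, solves the same wave equation with value 1 on both
characteristics. As q is only continuous, two differentiations are avoided: J and the double
integral vanish at t = x, and their t-derivatives agree by the flux identity combined with
`IsGoursatIntegral.odd_eq`. -/
theorem one_add_oddPrimitive_eq (hq : Continuous q)
    (hH : IsGoursatIntegral q (fun u => 1 / 2 * ∫ s in (0 : ℝ)..u, q s) H) (u v : ℝ) :
    oddPrimitive H (u + v) (u - v) = ∫ β in (0 : ℝ)..v, ∫ α in (0 : ℝ)..u,
      q (α + β) * (1 + oddPrimitive H (α + β) (α - β)) := by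
  have cJ := continuous_oddPrimitive hH.cont
  have cO : Continuous (Function.uncurry fun x t =>
      -(H ((x + t) / 2) ((x - t) / 2) - H ((x - t) / 2) ((x + t) / 2))) :=
    (continuous_odd hH.cont).neg
  have cw : Continuous fun p : ℝ × ℝ => 1 + oddPrimitive H p.1 p.2 := continuous_const.add cJ
  have cφ : Continuous (Function.uncurry fun α β : ℝ =>
      q (α + β) * (1 + oddPrimitive H (α + β) (α - β))) :=
    Continuous.mul (f := fun p : ℝ × ℝ => q (p.1 + p.2)) (by fun_prop)
      (cw.comp (by fun_prop : Continuous fun p : ℝ × ℝ => (p.1 + p.2, p.1 - p.2)))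
  set B : ℝ → ℝ → ℝ := fun u v => ∫ β in (0 : ℝ)..v, ∫ α in (0 : ℝ)..u,
      q (α + β) * (1 + oddPrimitive H (α + β) (α - β)) with hB
  have cBu : Continuous fun p : ℝ × ℝ =>
      ∫ β in (0 : ℝ)..p.2, q (p.1 + β) * (1 + oddPrimitive H (p.1 + β) (p.1 - β)) :=
    continuous_integral_moving (g := fun (p : ℝ × ℝ) β =>
      q (p.1 + β) * (1 + oddPrimitive H (p.1 + β) (p.1 - β)))
      (cφ.comp (by fun_prop : Continuous fun x : (ℝ × ℝ) × ℝ => (x.1.1, x.2)))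
      continuous_const continuous_snd
  have cBv : Continuous fun p : ℝ × ℝ =>
      ∫ α in (0 : ℝ)..p.1, q (α + p.2) * (1 + oddPrimitive H (α + p.2) (α - p.2)) :=
    continuous_integral_moving (g := fun (p : ℝ × ℝ) α =>
      q (α + p.2) * (1 + oddPrimitive H (α + p.2) (α - p.2)))
      (cφ.comp (by fun_prop : Continuous fun x : (ℝ × ℝ) × ℝ => (x.2, x.1.2)))
      continuous_const continuous_fst
  have flux : ∀ u v, (∫ β in (0 : ℝ)..v, q (u + β) * (1 + oddPrimitive H (u + β) (u - β)))
      - (∫ α in (0 : ℝ)..u, q (α + v) * (1 + oddPrimitive H (α + v) (α - v)))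
      = -2 * (H u v - H v u) := by
    intro u v
    have h := integral_characteristic_flux hq (w := fun x t => 1 + oddPrimitive H x t) cw cO
      (fun x t => (hasDerivAt_oddPrimitive hH.cont x t).const_add 1) u v
    simp only [oddPrimitive_diag, oddPrimitive_antidiag, add_zero, mul_one, add_sub_sub_cancel,
      add_add_sub_cancel, add_self_div_two] at h
    have e1 : ∫ β in (0 : ℝ)..v, (q (u + β) * (1 + oddPrimitive H (u + β) (u - β)) - q β)
        = (∫ β in (0 : ℝ)..v, q (u + β) * (1 + oddPrimitive H (u + β) (u - β)))
          - ∫ β in (0 : ℝ)..v, q β :=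
      intervalIntegral.integral_sub ((cφ.comp
        (by fun_prop : Continuous fun β : ℝ => (u, β))).intervalIntegrable _ _)
        (hq.intervalIntegrable _ _)
    have e2 : ∫ β in (0 : ℝ)..v, ∫ α in (0 : ℝ)..u, q (α + β) * -(H α β - H β α)
        = -∫ β in (0 : ℝ)..v, ∫ α in (0 : ℝ)..u, q (α + β) * (H α β - H β α) := by
      simp only [mul_neg, intervalIntegral.integral_neg]
    rw [e1, e2] at h
    have := hH.odd_eq hq u v
    rw [h]
    linarith
  have key : ∀ x t, oddPrimitive H x t = B ((x + t) / 2) ((x - t) / 2) := by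
    intro x t
    refine eq_of_hasDerivAt_eq (g := fun t => B ((x + t) / 2) ((x - t) / 2))
      (hasDerivAt_oddPrimitive hH.cont x) (fun t => ?_) (a := x)
      (by simp [oddPrimitive_diag, hB]) t
    have := hasDerivAt_comp_of_partials (f := fun p : ℝ × ℝ => B p.1 p.2)
      (fun p => hasDerivAt_integral_integral_fst cφ p.1 p.2)
      (fun p => hasDerivAt_integral_integral_snd cφ p.1 p.2) cBu cBv
      (((hasDerivAt_id t).const_add x).div_const 2) (((hasDerivAt_id t).const_sub x).div_const 2)
    refine this.congr_deriv ?_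
    have h := flux ((x + t) / 2) ((x - t) / 2)
    simp only [id]
    linarith
  rw [key]
  congr 2 <;> ring

/-- The kernel `𝐊(·,·;h)` solves the Goursat problem with data shifted by `h/2`. -/
theorem IsGoursatIntegral.shift (hq : Continuous q)
    (hH : IsGoursatIntegral q (fun u => 1 / 2 * ∫ s in (0 : ℝ)..u, q s) H) (h : ℝ) :
    IsGoursatIntegral q (fun u => h / 2 + 1 / 2 * ∫ s in (0 : ℝ)..u, q s)
      (fun u v => h / 2 + H u v + h / 2 * oddPrimitive H (u + v) (u - v)) := by
  have cJ : Continuous fun p : ℝ × ℝ => oddPrimitive H (p.1 + p.2) (p.1 - p.2) :=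
    (continuous_oddPrimitive hH.cont).comp
      (by fun_prop : Continuous fun p : ℝ × ℝ => (p.1 + p.2, p.1 - p.2))
  have cH : Continuous fun p : ℝ × ℝ => H p.1 p.2 := hH.cont
  refine ⟨Continuous.add (continuous_const.add cH) (continuous_const.mul cJ), fun u v => ?_⟩
  have c1 : Continuous (Function.uncurry fun α β => q (α + β) * H α β) :=
    hH.continuous_integrand hq
  have c2 : Continuous (Function.uncurry fun α β =>
      q (α + β) * (1 + oddPrimitive H (α + β) (α - β))) :=
    Continuous.mul (f := fun p : ℝ × ℝ => q (p.1 + p.2)) (by fun_prop) (continuous_const.add cJ)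
  have i1 : ∀ {φ : ℝ → ℝ → ℝ}, Continuous (Function.uncurry φ) → ∀ β,
      IntervalIntegrable (fun α => φ α β) volume 0 u := fun h β =>
    (h.comp (by fun_prop : Continuous fun α : ℝ => (α, β))).intervalIntegrable _ _
  have i2 : ∀ {φ : ℝ → ℝ → ℝ}, Continuous (Function.uncurry φ) →
      IntervalIntegrable (fun β => ∫ α in (0 : ℝ)..u, φ α β) volume 0 v := fun {φ} h =>
    (continuous_integral_moving (g := fun β α => φ α β) (h.comp continuous_swap)
      continuous_const continuous_const).intervalIntegrable _ _
  have e : ∫ β in (0 : ℝ)..v, ∫ α in (0 : ℝ)..u,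
        q (α + β) * (h / 2 + H α β + h / 2 * oddPrimitive H (α + β) (α - β))
      = (∫ β in (0 : ℝ)..v, ∫ α in (0 : ℝ)..u, q (α + β) * H α β)
        + h / 2 * ∫ β in (0 : ℝ)..v, ∫ α in (0 : ℝ)..u,
          q (α + β) * (1 + oddPrimitive H (α + β) (α - β)) := by
    rw [← intervalIntegral.integral_const_mul,
      ← intervalIntegral.integral_add (i2 c1) ((i2 c2).const_mul _)]
    refine integral_congr fun β _ => ?_
    refine Eq.trans ?_ ((intervalIntegral.integral_add (i1 c1 β) ((i1 c2 β).const_mul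
      (h / 2))).trans (congrArg _ (intervalIntegral.integral_const_mul _ _)))
    exact integral_congr fun α _ => by ring
  rw [e, ← one_add_oddPrimitive_eq hq hH, hH.eq u v]
  ring

end oddPart

/-! ### The Darboux partner of a Goursat kernel -/

section superpotential

variable {χ : ℝ → ℝ}

theorem hasDerivAt_of_contDiff_two (hχ : ContDiff ℝ 2 χ) (x : ℝ) :
    HasDerivAt χ (deriv χ x) x :=
  (hχ.differentiable (by simp) x).hasDerivAt

theorem contDiff_one_deriv (hχ : ContDiff ℝ 2 χ) : ContDiff ℝ 1 (deriv χ) :=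
  (contDiff_succ_iff_deriv (n := 1).1 (hχ.of_le (by norm_num))).2.2

theorem hasDerivAt_deriv_of_contDiff_two (hχ : ContDiff ℝ 2 χ) (x : ℝ) :
    HasDerivAt (deriv χ) (deriv (deriv χ) x) x :=
  ((contDiff_one_deriv hχ).differentiable (by simp) x).hasDerivAt

theorem continuous_potential (hχ : ContDiff ℝ 2 χ) : Continuous (potential χ) := by
  have h1 := (contDiff_one_deriv hχ)
  have h2 : Continuous (deriv (deriv χ)) :=
    (contDiff_succ_iff_deriv (n := 0).1 (by simpa using h1)).2.2.continuous
  exact h2.add (h1.continuous.pow 2)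

/-- This is f'' = q f for f = e^χ, the reason why q factorizes. -/
theorem hasDerivAt_deriv_mul_exp (hχ : ContDiff ℝ 2 χ) (x : ℝ) :
    HasDerivAt (fun x => deriv χ x * Real.exp (χ x)) (potential χ x * Real.exp (χ x)) x := by
  refine ((hasDerivAt_deriv_of_contDiff_two hχ x).mul
    (hasDerivAt_of_contDiff_two hχ x).exp).congr_deriv ?_
  simp only [potential]
  ring

/-- A potential, in characteristic coordinates, of the closed form
`M ∂_u f(u+v) du + f(u+v) ∂_v M dv`, `f = e^χ`. -/
def greenPotential (χ : ℝ → ℝ) (M : ℝ → ℝ → ℝ) (u v : ℝ) : ℝ :=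
  ∫ α in (0 : ℝ)..u, M α v * (deriv χ (α + v) * Real.exp (χ (α + v)))

variable {M : ℝ → ℝ → ℝ} {g : ℝ → ℝ}

theorem continuous_greenIntegrand (hχ : ContDiff ℝ 2 χ) (hM : Continuous (Function.uncurry M)) :
    Continuous fun p : ℝ × ℝ =>
      M p.1 p.2 * (deriv χ (p.1 + p.2) * Real.exp (χ (p.1 + p.2))) := by
  have c1 := (contDiff_one_deriv hχ).continuous
  have c0 := hχ.continuous
  exact hM.mul (by fun_prop)

theorem hasDerivAt_greenPotential_fst (hχ : ContDiff ℝ 2 χ)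
    (hM : Continuous (Function.uncurry M)) (u v : ℝ) :
    HasDerivAt (fun u => greenPotential χ M u v)
      (M u v * (deriv χ (u + v) * Real.exp (χ (u + v)))) u :=
  hasDerivAt_primitive ((continuous_greenIntegrand hχ hM).comp
    (by fun_prop : Continuous fun α : ℝ => (α, v))) _ _

/-- Closedness of the form: ∂_v(M f') and ∂_u(f M_v) both equal f' M_v + q f M. Differentiating
under the integral thus leaves the integral of a u-derivative, and M_v vanishes at u = 0. -/
theorem hasDerivAt_greenPotential_snd (hχ : ContDiff ℝ 2 χ)
    (hM : IsGoursatIntegral (potential χ) g M) (u v : ℝ) :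
    HasDerivAt (fun v => greenPotential χ M u v)
      (Real.exp (χ (u + v)) * ∫ α in (0 : ℝ)..u, potential χ (α + v) * M α v) v := by
  have cq := continuous_potential hχ
  have c1 := (contDiff_one_deriv hχ).continuous
  have c0 := hχ.continuous
  have cm := hM.continuous_deriv_snd cq
  have shift : ∀ {f : ℝ → ℝ} {f' x y : ℝ}, HasDerivAt f f' (x + y) →
      HasDerivAt (fun y => f (x + y)) f' y := fun h => by
    simpa using h.comp_const_add _ _
  have shift' : ∀ {f : ℝ → ℝ} {f' x y : ℝ}, HasDerivAt f f' (x + y) →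
      HasDerivAt (fun x => f (x + y)) f' x := fun h => by
    simpa using h.comp_add_const _ _
  have cg : Continuous (Function.uncurry fun v α =>
      (∫ a in (0 : ℝ)..α, potential χ (a + v) * M a v)
          * (deriv χ (α + v) * Real.exp (χ (α + v)))
        + M α v * (potential χ (α + v) * Real.exp (χ (α + v)))) := by
    have cs := hM.cont.comp continuous_swap
    refine Continuous.add (Continuous.mul
      (f := fun p : ℝ × ℝ => ∫ a in (0 : ℝ)..p.2, potential χ (a + p.1) * M a p.1)
      (cm.comp continuous_swap) ?_) (Continuous.mul (f := fun p : ℝ × ℝ => M p.2 p.1) cs ?_)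
    · fun_prop
    · fun_prop
  have h := hasDerivAt_integral_param
    (g := fun v α => M α v * (deriv χ (α + v) * Real.exp (χ (α + v))))
    (fun v => (continuous_greenIntegrand hχ hM.cont).comp
      (by fun_prop : Continuous fun α : ℝ => (α, v))) cg
    (fun v α => (hM.hasDerivAt_snd cq α v).mul (shift (hasDerivAt_deriv_mul_exp hχ (α + v))))
    0 u v
  refine h.congr_deriv ?_
  refine eq_of_hasDerivAt_eq (a := 0)
    (g := fun u => Real.exp (χ (u + v)) * ∫ α in (0 : ℝ)..u, potential χ (α + v) * M α v)
    (fun u => hasDerivAt_primitive (cg.comp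
      (by fun_prop : Continuous fun α : ℝ => (v, α))) 0 u) (fun u => ?_) (by simp) u
  refine ((shift' (hasDerivAt_of_contDiff_two hχ (u + v)).exp).mul
    (hM.hasDerivAt_deriv_snd cq u v)).congr_deriv ?_
  simp only [Function.comp_apply, Function.uncurry]
  ring

/-- The required equations for l say that e^χ (l + k) has x-derivative e^χ (c M + M_v) and
t-derivative e^χ (c M - M_v). These are the derivatives of 2Φ, and both functions vanish on the
antidiagonal u = 0, which determines l. -/
theorem exists_isDarbouxPair (hχ : ContDiff ℝ 2 χ) (hχ0 : χ 0 = 0)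
    (hM : IsGoursatIntegral (potential χ)
      (fun u => deriv χ 0 / 2 + 1 / 2 * ∫ s in (0 : ℝ)..u, potential χ s) M) :
    ∃ l kt lt, IsDarbouxPair (deriv χ) (deriv χ 0 / 2)
      (fun x t => M ((x + t) / 2) ((x - t) / 2)) l kt lt := by
  have cq := continuous_potential hχ
  have c1 := (contDiff_one_deriv hχ).continuous
  have c0 := hχ.continuous
  set Mv : ℝ × ℝ → ℝ := fun p => ∫ α in (0 : ℝ)..p.1, potential χ (α + p.2) * M α p.2 with hMv
  set Mu : ℝ × ℝ → ℝ := fun p => 1 / 2 * potential χ p.1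
    + ∫ β in (0 : ℝ)..p.2, potential χ (p.1 + β) * M p.1 β with hMu
  have cMv : Continuous Mv := hM.continuous_deriv_snd cq
  have cMu : Continuous Mu :=
    hM.continuous_deriv_fst (g' := fun u => 1 / 2 * potential χ u) cq (by fun_prop)
  have dMv : ∀ p : ℝ × ℝ, HasDerivAt (fun s => M p.1 s) (Mv p) p.2 :=
    fun p => hM.hasDerivAt_snd cq p.1 p.2
  have dMu : ∀ p : ℝ × ℝ, HasDerivAt (fun s => M s p.2) (Mu p) p.1 :=
    fun p => hM.hasDerivAt_fst (g' := fun u => 1 / 2 * potential χ u) cq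
      (fun u => ((hasDerivAt_primitive cq 0 u).const_mul _).const_add _) p.1 p.2
  have cM : Continuous fun p : ℝ × ℝ => M p.1 p.2 := hM.cont
  set Φ := greenPotential χ M with hΦ
  have dΦu := hasDerivAt_greenPotential_fst hχ hM.cont
  have dΦv := hasDerivAt_greenPotential_snd hχ hM
  have cΦu := continuous_greenIntegrand hχ hM.cont
  have cΦv : Continuous fun p : ℝ × ℝ => Real.exp (χ (p.1 + p.2)) * Mv p := by fun_prop
  have cΦ : Continuous fun p : ℝ × ℝ => Φ p.1 p.2 := continuous_iff_continuousAt.2 fun p =>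
    (hasStrictFDerivAt_of_partials (f := fun p : ℝ × ℝ => Φ p.1 p.2) (fun p => dΦu p.1 p.2)
      (fun p => dΦv p.1 p.2) cΦu cΦv p).continuousAt
  have cchar : Continuous fun p : ℝ × ℝ => ((p.1 + p.2) / 2, (p.1 - p.2) / 2) := by fun_prop
  have ax : ∀ x t : ℝ, HasDerivAt (fun x => (x + t) / 2) (1 / 2) x := fun x t =>
    ((hasDerivAt_id x).add_const t).div_const 2
  have bx : ∀ x t : ℝ, HasDerivAt (fun x => (x - t) / 2) (1 / 2) x := fun x t =>
    ((hasDerivAt_id x).sub_const t).div_const 2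
  have at' : ∀ x t : ℝ, HasDerivAt (fun t => (x + t) / 2) (1 / 2) t := fun x t =>
    ((hasDerivAt_id t).const_add x).div_const 2
  have bt : ∀ x t : ℝ, HasDerivAt (fun t => (x - t) / 2) (-1 / 2) t := fun x t =>
    ((hasDerivAt_id t).const_sub x).div_const 2
  have sum1 : ∀ x t : ℝ, (x + t) / 2 + (x - t) / 2 = x := fun x t => by ring
  have dkx : ∀ x t, HasDerivAt (fun s => M ((s + t) / 2) ((s - t) / 2))
      (1 / 2 * Mu ((x + t) / 2, (x - t) / 2) + 1 / 2 * Mv ((x + t) / 2, (x - t) / 2)) x :=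
    fun x t => hasDerivAt_comp_of_partials (f := fun p => M p.1 p.2) dMu dMv cMu cMv (ax x t)
      (bx x t)
  have dkt : ∀ x t, HasDerivAt (fun s => M ((x + s) / 2) ((x - s) / 2))
      (1 / 2 * Mu ((x + t) / 2, (x - t) / 2) + -1 / 2 * Mv ((x + t) / 2, (x - t) / 2)) t :=
    fun x t => hasDerivAt_comp_of_partials (f := fun p => M p.1 p.2) dMu dMv cMu cMv (at' x t)
      (bt x t)
  have dΦx : ∀ x t, HasDerivAt (fun s => Φ ((s + t) / 2) ((s - t) / 2))
      (1 / 2 * (M ((x + t) / 2) ((x - t) / 2) * (deriv χ x * Real.exp (χ x)))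
        + 1 / 2 * (Real.exp (χ x) * Mv ((x + t) / 2, (x - t) / 2))) x := fun x t => by
    have := hasDerivAt_comp_of_partials (f := fun p : ℝ × ℝ => Φ p.1 p.2) (fun p => dΦu p.1 p.2)
      (fun p => dΦv p.1 p.2) cΦu cΦv (ax x t) (bx x t)
    simpa only [sum1] using this
  have dΦt : ∀ x t, HasDerivAt (fun s => Φ ((x + s) / 2) ((x - s) / 2))
      (1 / 2 * (M ((x + t) / 2) ((x - t) / 2) * (deriv χ x * Real.exp (χ x)))
        + -1 / 2 * (Real.exp (χ x) * Mv ((x + t) / 2, (x - t) / 2))) t := fun x t => by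
    have := hasDerivAt_comp_of_partials (f := fun p : ℝ × ℝ => Φ p.1 p.2) (fun p => dΦu p.1 p.2)
      (fun p => dΦv p.1 p.2) cΦu cΦv (at' x t) (bt x t)
    simpa only [sum1] using this
  have hexp : ∀ x, Real.exp (-χ x) * Real.exp (χ x) = 1 := fun x => by
    rw [← Real.exp_add]; simp
  have ck := cM.comp cchar
  have cu := cMu.comp cchar
  have cv := cMv.comp cchar
  refine ⟨fun x t => -M ((x + t) / 2) ((x - t) / 2)
      + 2 * Real.exp (-χ x) * Φ ((x + t) / 2) ((x - t) / 2),
    fun x t => 1 / 2 * Mu ((x + t) / 2, (x - t) / 2) + -1 / 2 * Mv ((x + t) / 2, (x - t) / 2),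
    fun x t => deriv χ x * M ((x + t) / 2) ((x - t) / 2)
      - (1 / 2 * Mu ((x + t) / 2, (x - t) / 2) + 1 / 2 * Mv ((x + t) / 2, (x - t) / 2)),
    ⟨c1, ck, ?_, ?_, ?_, dkt, ?_, ?_, ?_, ?_, ?_, ?_⟩⟩
  · exact ck.neg.add (Continuous.mul (f := fun p : ℝ × ℝ => 2 * Real.exp (-χ p.1))
      (by fun_prop) (cΦ.comp cchar))
  · exact (continuous_const.mul cu).add (continuous_const.mul cv)
  · exact ((c1.comp continuous_fst).mul ck).sub
      ((continuous_const.mul cu).add (continuous_const.mul cv))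
  · intro x t
    refine ((dkt x t).neg.add ((dΦt x t).const_mul (2 * Real.exp (-χ x)))).congr_deriv ?_
    linear_combination (deriv χ x * M ((x + t) / 2) ((x - t) / 2)
      - Mv ((x + t) / 2, (x - t) / 2)) * hexp x
  · intro x t
    exact (dkx x t).congr_deriv (by ring)
  · intro x t
    refine ((dkx x t).neg.add ((((hasDerivAt_of_contDiff_two hχ x).neg.exp).const_mul 2).mul
      (dΦx x t))).congr_deriv ?_
    simp only [Pi.neg_apply]
    linear_combination (deriv χ x * M ((x + t) / 2) ((x - t) / 2)
      + Mv ((x + t) / 2, (x - t) / 2)) * hexp x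
  · intro x
    rw [hM.eq]
    simp
  · intro x
    rw [hM.eq]
    simp [hΦ, greenPotential]
  · intro x
    have hm : ∀ u, M u 0 = deriv χ 0 / 2 + 1 / 2 * ∫ s in (0 : ℝ)..u, potential χ s := fun u => by
      rw [hM.eq]; simp
    -- The diagonal condition multiplied by e^χ. Both sides vanish at 0, and the derivatives agree
    -- because M_u(x, 0) = q(x)/2; the shift h/2 in the data is what makes the values at 0 match.
    have key : 2 * Φ x 0 = 2 * M x 0 * Real.exp (χ x) - deriv χ x * Real.exp (χ x) := by
      refine eq_of_hasDerivAt_eq (a := 0) (f := fun x => 2 * Φ x 0)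
        (g := fun x => 2 * M x 0 * Real.exp (χ x) - deriv χ x * Real.exp (χ x))
        (fun x => (dΦu x 0).const_mul 2) (fun x => ?_) ?_ x
      · refine ((((dMu (x, 0)).const_mul 2).mul (hasDerivAt_of_contDiff_two hχ x).exp).sub
          (hasDerivAt_deriv_mul_exp hχ x)).congr_deriv ?_
        simp only [hMu, integral_same, add_zero]
        ring
      · simp only [hm]
        simp [hΦ, greenPotential, hχ0, mul_div_cancel₀]
    simp only [sub_self, zero_div, add_self_div_two]
    linear_combination Real.exp (-χ x) * key
      + (2 * M x 0 - deriv χ x) * hexp x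

/-- The equation (∂_x + χ') l = -∂_t k says ∂_x(e^χ l) = -e^χ ∂_t k. Integrate it in x from the
antidiagonal point -t, where l = -b. -/
theorem IsDarbouxPair.second_kernel_eq {b : ℝ} {k l kt lt : ℝ → ℝ → ℝ} (hχ : ContDiff ℝ 2 χ)
    (h : IsDarbouxPair (deriv χ) b k l kt lt) (x t : ℝ) :
    l x t = -Real.exp (-χ x)
      * ((∫ s in (-t)..x, kt s t * Real.exp (χ s)) + b * Real.exp (χ (-t))) := by
  have c0 := hχ.continuous
  have ck : Continuous fun s => kt s t :=
    h.cont_kt.comp (by fun_prop : Continuous fun s : ℝ => (s, t))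
  have e : ∫ s in (-t)..x, kt s t * Real.exp (χ s)
      = -(Real.exp (χ x) * l x t) - -(Real.exp (χ (-t)) * l (-t) t) := by
    refine integral_eq_sub_of_hasDerivAt (f := fun s => -(Real.exp (χ s) * l s t))
      (fun s _ => ?_) (Continuous.intervalIntegrable (by fun_prop) _ _)
    refine ((hasDerivAt_of_contDiff_two hχ s).exp.mul (h.deriv_x_l s t)).neg.congr_deriv ?_
    ring
  have ha := h.antidiag_l (-t)
  rw [neg_neg] at ha
  have hexp : Real.exp (-χ x) * Real.exp (χ x) = 1 := by
    rw [← Real.exp_add]; simp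
  rw [e, ha]
  linear_combination -l x t * hexp

end superpotential

/-! ### Localization -/

theorem contDiff_smul_of_tsupport_subset {E F : Type*} [NormedAddCommGroup E] [NormedSpace ℝ E]
    [NormedAddCommGroup F] [NormedSpace ℝ F] {n : ℕ} {U : Set E} (hU : IsOpen U) {f : E → F}
    (hf : ContDiffOn ℝ n f U) {φ : E → ℝ} (hφ : ContDiff ℝ n φ) (hs : tsupport φ ⊆ U) :
    ContDiff ℝ n fun x => φ x • f x := by
  rw [contDiff_iff_contDiffAt]
  intro x
  by_cases hx : x ∈ tsupport φ
  · exact hφ.contDiffAt.smul (hf.contDiffAt (hU.mem_nhds (hs hx)))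
  · have h0 : (fun x => φ x • f x) =ᶠ[𝓝 x] fun _ => 0 := by
      filter_upwards [(isClosed_tsupport φ).isOpen_compl.mem_nhds hx] with y hy
      rw [image_eq_zero_of_notMem_tsupport hy, zero_smul]
    exact contDiffAt_const.congr_of_eventuallyEq h0

theorem exists_cutoff {r R : ℝ} (hr : 0 < r) (hR : r < R) : ∃ φ : ℝ → ℝ, ContDiff ℝ 2 φ ∧
    (∀ x ∈ Icc (-r) r, φ x = 1) ∧ tsupport φ ⊆ Ioo (-R) R ∧ HasCompactSupport φ := by
  let φ : ContDiffBump (0 : ℝ) := ⟨r, (r + R) / 2, hr, by linarith⟩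
  refine ⟨φ, φ.contDiff, fun x hx => φ.one_of_mem_closedBall ?_, ?_, φ.hasCompactSupport⟩
  · rw [Real.closedBall_eq_Icc]
    simpa using hx
  · rw [φ.tsupport_eq, Real.closedBall_eq_Icc]
    intro x hx
    have h1 : φ.rOut = (r + R) / 2 := rfl
    rw [h1] at hx
    constructor <;> linarith [hx.1, hx.2]

/-- The superpotential is cut off, not the potential, so that the new potential still has the form
ψ'' + (ψ')² and the Darboux construction remains available. -/
theorem exists_contDiff_extension {a r : ℝ} (hr : 0 < r) (hra : r < a) {χ : ℝ → ℝ}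
    (hχ : ContDiffOn ℝ 2 χ (Ioo (-a) a)) :
    ∃ ψ : ℝ → ℝ, ContDiff ℝ 2 ψ ∧ HasCompactSupport ψ ∧ ∀ x ∈ Icc (-r) r, ψ x = χ x := by
  obtain ⟨φ, hφ, h1, hs, hc⟩ := exists_cutoff hr hra
  refine ⟨fun x => φ x • χ x, contDiff_smul_of_tsupport_subset (n := 2) isOpen_Ioo hχ hφ hs,
    hc.smul_right, fun x hx => ?_⟩
  simp [h1 x hx]

theorem eventuallyEq_of_eq_on_Icc {r : ℝ} {χ ψ : ℝ → ℝ} (h : ∀ x ∈ Icc (-r) r, ψ x = χ x)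
    {x : ℝ} (hx : x ∈ Ioo (-r) r) : ψ =ᶠ[𝓝 x] χ := by
  filter_upwards [isOpen_Ioo.mem_nhds hx] with y hy using h y (Ioo_subset_Icc_self hy)

theorem potential_congr {χ ψ : ℝ → ℝ} {x : ℝ} (h : ψ =ᶠ[𝓝 x] χ) :
    potential ψ x = potential χ x := by
  rw [potential, potential, h.deriv.deriv_eq, h.deriv_eq]

theorem exists_potential_bound {ψ : ℝ → ℝ} (hψ : ContDiff ℝ 2 ψ) (hc : HasCompactSupport ψ) :
    ∃ B, ∀ s, |potential ψ s| ≤ B := by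
  have hs : HasCompactSupport (potential ψ) := by
    have h1 := hc.deriv
    refine (h1.deriv).add (f' := fun x => deriv ψ x ^ 2) ?_
    exact h1.comp_left (g := fun y : ℝ => y ^ 2) (by simp)
  obtain ⟨B, hB⟩ := hs.exists_bound_of_continuous (continuous_potential hψ)
  exact ⟨B, hB⟩

theorem exists_goursat_of_hasCompactSupport {ψ : ℝ → ℝ} (hψ : ContDiff ℝ 2 ψ)
    (hc : HasCompactSupport ψ) :
    ∃ W, IsGoursatIntegral (potential ψ) (fun u => 1 / 2 * ∫ s in (0 : ℝ)..u, potential ψ s)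
      W := by
  obtain ⟨B, hB⟩ := exists_potential_bound hψ hc
  have cq := continuous_potential hψ
  refine exists_isGoursatIntegral cq (continuous_const.mul
    (continuous_primitive (fun a b => cq.intervalIntegrable a b) 0)) hB fun s => ?_
  have hB0 : 0 ≤ B := (abs_nonneg _).trans (hB 0)
  have h1 : |∫ s in (0 : ℝ)..s, potential ψ s| ≤ B * |s| := by
    have := norm_integral_le_of_norm_le_const (a := 0) (b := s) (f := potential ψ) (C := B)
      (fun x _ => hB x)
    simpa using this
  have h2 : |s| ≤ Real.exp |s| := by linarith [Real.add_one_le_exp |s|]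
  rw [abs_mul, abs_of_pos (by norm_num : (0 : ℝ) < 1 / 2)]
  nlinarith [abs_nonneg s, mul_le_mul_of_nonneg_left h2 hB0, mul_nonneg hB0 (abs_nonneg s)]

/-! ### Uniqueness on diamonds -/

theorem uIcc_zero_abs_le {u α : ℝ} (h : α ∈ uIcc 0 u) : |α| ≤ |u| := by
  simpa using abs_sub_left_of_mem_uIcc h

theorem clamp_mem (u x : ℝ) : max (min 0 u) (min x (max 0 u)) ∈ uIcc 0 u :=
  ⟨le_max_left _ _, max_le (min_le_max) (min_le_right _ _)⟩

theorem clamp_eq {u x : ℝ} (h : x ∈ uIcc 0 u) : max (min 0 u) (min x (max 0 u)) = x := by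
  have h1 : min 0 u ≤ x := h.1
  have h2 : x ≤ max 0 u := h.2
  rw [min_eq_left h2, max_eq_right h1]

/-- Precomposition with the nearest-point projection onto the rectangle. It lets results for
globally continuous integrands be used on a rectangle. -/
theorem exists_continuous_extension_rect {φ : ℝ → ℝ → ℝ} {u v : ℝ}
    (h : ContinuousOn (Function.uncurry φ) (uIcc 0 u ×ˢ uIcc 0 v)) :
    ∃ ψ : ℝ → ℝ → ℝ, Continuous (Function.uncurry ψ) ∧
      ∀ α ∈ uIcc 0 u, ∀ β ∈ uIcc 0 v, ψ α β = φ α β := by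
  refine ⟨fun α β => φ (max (min 0 u) (min α (max 0 u))) (max (min 0 v) (min β (max 0 v))),
    ?_, fun α hα β hβ => by simp only [clamp_eq hα, clamp_eq hβ]⟩
  exact h.comp_continuous (f := fun p : ℝ × ℝ =>
    (max (min 0 u) (min p.1 (max 0 u)), max (min 0 v) (min p.2 (max 0 v)))) (by fun_prop)
    fun p => ⟨clamp_mem _ _, clamp_mem _ _⟩

theorem integral_integral_congr {φ ψ : ℝ → ℝ → ℝ} {u v : ℝ}
    (h : ∀ α ∈ uIcc 0 u, ∀ β ∈ uIcc 0 v, ψ α β = φ α β) :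
    ∫ β in (0 : ℝ)..v, ∫ α in (0 : ℝ)..u, ψ α β
      = ∫ β in (0 : ℝ)..v, ∫ α in (0 : ℝ)..u, φ α β :=
  integral_congr fun β hβ => integral_congr fun α hα => h α hα β hβ

theorem integral_integral_sub_of_continuousOn {φ₁ φ₂ : ℝ → ℝ → ℝ} {u v : ℝ}
    (h₁ : ContinuousOn (Function.uncurry φ₁) (uIcc 0 u ×ˢ uIcc 0 v))
    (h₂ : ContinuousOn (Function.uncurry φ₂) (uIcc 0 u ×ˢ uIcc 0 v)) :
    ∫ β in (0 : ℝ)..v, ∫ α in (0 : ℝ)..u, (φ₁ α β - φ₂ α β)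
      = (∫ β in (0 : ℝ)..v, ∫ α in (0 : ℝ)..u, φ₁ α β)
        - ∫ β in (0 : ℝ)..v, ∫ α in (0 : ℝ)..u, φ₂ α β := by
  obtain ⟨ψ₁, c₁, e₁⟩ := exists_continuous_extension_rect h₁
  obtain ⟨ψ₂, c₂, e₂⟩ := exists_continuous_extension_rect h₂
  have i1 : ∀ {φ : ℝ → ℝ → ℝ}, Continuous (Function.uncurry φ) → ∀ β,
      IntervalIntegrable (fun α => φ α β) volume 0 u := fun h β =>
    (h.comp (by fun_prop : Continuous fun α : ℝ => (α, β))).intervalIntegrable _ _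
  have i2 : ∀ {φ : ℝ → ℝ → ℝ}, Continuous (Function.uncurry φ) →
      IntervalIntegrable (fun β => ∫ α in (0 : ℝ)..u, φ α β) volume 0 v := fun {φ} h =>
    (continuous_integral_moving (g := fun β α => φ α β) (h.comp continuous_swap)
      continuous_const continuous_const).intervalIntegrable _ _
  rw [← integral_integral_congr e₁, ← integral_integral_congr e₂,
    ← integral_integral_congr (ψ := fun α β => ψ₁ α β - ψ₂ α β)
      (fun α hα β hβ => by rw [e₁ α hα β hβ, e₂ α hα β hβ]),
    ← intervalIntegral.integral_sub (i2 c₁) (i2 c₂)]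
  exact integral_congr fun β _ => intervalIntegral.integral_sub (i1 c₁ β) (i1 c₂ β)

/-- Two solutions of the integral equation on a diamond coincide. -/
theorem goursat_unique {q g : ℝ → ℝ} {W₁ W₂ : ℝ → ℝ → ℝ} {r : ℝ}
    (hq : ContinuousOn q (Icc (-r) r))
    (c₁ : ContinuousOn (Function.uncurry W₁) {p : ℝ × ℝ | |p.1| + |p.2| ≤ r})
    (c₂ : ContinuousOn (Function.uncurry W₂) {p : ℝ × ℝ | |p.1| + |p.2| ≤ r})
    (h₁ : ∀ u v, |u| + |v| ≤ r →
      W₁ u v = g u + ∫ β in (0 : ℝ)..v, ∫ α in (0 : ℝ)..u, q (α + β) * W₁ α β)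
    (h₂ : ∀ u v, |u| + |v| ≤ r →
      W₂ u v = g u + ∫ β in (0 : ℝ)..v, ∫ α in (0 : ℝ)..u, q (α + β) * W₂ α β)
    {u v : ℝ} (huv : |u| + |v| ≤ r) : W₁ u v = W₂ u v := by
  obtain ⟨B, hB⟩ := isCompact_Icc.exists_bound_of_continuousOn hq
  have rect : ∀ {u v : ℝ}, |u| + |v| ≤ r →
      uIcc 0 u ×ˢ uIcc 0 v ⊆ {p : ℝ × ℝ | |p.1| + |p.2| ≤ r} := fun h p hp =>
    (add_le_add (uIcc_zero_abs_le hp.1) (uIcc_zero_abs_le hp.2)).trans h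
  have cq : ContinuousOn (fun p : ℝ × ℝ => q (p.1 + p.2)) {p : ℝ × ℝ | |p.1| + |p.2| ≤ r} :=
    hq.comp (by fun_prop) fun p hp => abs_le.1 ((abs_add_le _ _).trans hp)
  have := eq_zero_of_goursat_homogeneous (d := fun u v => W₁ u v - W₂ u v)
    (fun s hs => hB s (abs_le.1 hs)) (c₁.sub c₂) (fun u v h => by
      rw [h₁ u v h, h₂ u v h, add_sub_add_left_eq_sub,
        ← integral_integral_sub_of_continuousOn
          (φ₁ := fun α β => q (α + β) * W₁ α β) (φ₂ := fun α β => q (α + β) * W₂ α β)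
          ((cq.mul c₁).mono (rect h)) ((cq.mul c₂).mono (rect h))]
      exact integral_integral_congr fun α _ β _ => by ring) huv
  exact sub_eq_zero.1 this

/-- Finite propagation: for |u| + |v| ≤ r the equation samples the potential only on [-r, r]. -/
theorem IsGoursatIntegral.eq_of_eqOn {q q' : ℝ → ℝ} {W : ℝ → ℝ → ℝ} {r : ℝ}
    (h : IsGoursatIntegral q' (fun u => 1 / 2 * ∫ s in (0 : ℝ)..u, q' s) W)
    (hq : ∀ s, |s| ≤ r → q' s = q s) {u v : ℝ} (huv : |u| + |v| ≤ r) :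
    W u v = 1 / 2 * (∫ s in (0 : ℝ)..u, q s)
      + ∫ β in (0 : ℝ)..v, ∫ α in (0 : ℝ)..u, q (α + β) * W α β := by
  rw [h.eq]
  refine congrArg₂ (fun x y => 1 / 2 * x + y) ?_ ?_
  · exact integral_congr fun s hs =>
      hq s ((uIcc_zero_abs_le hs).trans (by linarith [abs_nonneg v]))
  · refine integral_integral_congr fun α hα β hβ => ?_
    rw [hq]
    have := uIcc_zero_abs_le hα
    have := uIcc_zero_abs_le hβ
    linarith [abs_add_le α β]

/-- The square in (x, t) is a diamond in (u, v), which contains with each point its characteristic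
rectangle to the origin. -/
theorem mem_diamond_iff {u v r : ℝ} :
    (u + v ∈ Ioo (-r) r ∧ u - v ∈ Ioo (-r) r) ↔ |u| + |v| < r := by
  rw [mem_Ioo, mem_Ioo]
  constructor
  · rintro ⟨⟨_, _⟩, _, _⟩
    rcases abs_cases u with ⟨h, _⟩ | ⟨h, _⟩ <;> rcases abs_cases v with ⟨h', _⟩ | ⟨h', _⟩ <;>
      rw [h, h'] <;> linarith
  · intro h
    have := neg_abs_le u
    have := neg_abs_le v
    have := le_abs_self u
    have := le_abs_self v
    refine ⟨⟨?_, ?_⟩, ?_, ?_⟩ <;> linarith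

theorem continuousOn_potential {a : ℝ} {χ : ℝ → ℝ} (hχ : ContDiffOn ℝ 2 χ (Ioo (-a) a)) :
    ContinuousOn (potential χ) (Ioo (-a) a) := by
  have h1 : ContDiffOn ℝ 1 (deriv χ) (Ioo (-a) a) :=
    hχ.deriv_of_isOpen isOpen_Ioo (by norm_num)
  have h2 : ContDiffOn ℝ 0 (deriv (deriv χ)) (Ioo (-a) a) :=
    h1.deriv_of_isOpen isOpen_Ioo (by norm_num)
  exact h2.continuousOn.add (h1.continuousOn.pow 2)

/-- A solution of the Goursat problem solves the integral equation. -/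
theorem IsGoursatSolution.integral_eq {a : ℝ} {q : ℝ → ℝ} {K : ℝ → ℝ → ℝ}
    (hK : IsGoursatSolution a q K) (hq : ContinuousOn q (Ioo (-a) a)) {u v : ℝ}
    (huv : |u| + |v| < a) :
    K (u + v) (u - v) = 1 / 2 * (∫ s in (0 : ℝ)..u, q s)
      + ∫ β in (0 : ℝ)..v, ∫ α in (0 : ℝ)..u, q (α + β) * K (α + β) (α - β) := by
  set D : Set (ℝ × ℝ) := {p | |p.1| + |p.2| < a} with hD
  have oD : IsOpen D := isOpen_lt (by fun_prop) continuous_const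
  have mD : MapsTo (fun p : ℝ × ℝ => (p.1 + p.2, p.1 - p.2)) D (Ioo (-a) a ×ˢ Ioo (-a) a) :=
    fun p hp => mem_diamond_iff.2 hp
  set F : ℝ × ℝ → ℝ := fun p => K (p.1 + p.2) (p.1 - p.2) with hF
  have cF : ContDiffOn ℝ 1 F D :=
    hK.contDiffOn.comp (f := fun p : ℝ × ℝ => (p.1 + p.2, p.1 - p.2)) (by fun_prop) mD
  have dF : ∀ p ∈ D, HasDerivAt (fun s => F (p.1, s)) (partialD 1 F p) p.2 := fun p hp =>
    hasDerivAt_partialD_one ((cF.contDiffAt (oD.mem_nhds hp)).differentiableAt (by simp))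
  have cFv : ContinuousOn (partialD 1 F) D := by
    have h1 : ContinuousOn (fun p => fderiv ℝ F p (0, 1)) D :=
      (cF.continuousOn_fderiv_of_isOpen oD le_rfl).clm_apply continuousOn_const
    refine h1.congr fun p hp => ?_
    rw [partialD_eq_fderiv ((cF.contDiffAt (oD.mem_nhds hp)).differentiableAt (by simp))]
    simp
  have sub1 : ∀ {u v : ℝ}, |u| + |v| < a → ∀ α ∈ uIcc 0 u, (α, v) ∈ D := fun h α hα =>
    (add_le_add_left (uIcc_zero_abs_le hα) _).trans_lt h
  have sub2 : ∀ {u v : ℝ}, |u| + |v| < a → ∀ β ∈ uIcc 0 v, (u, β) ∈ D := fun h β hβ =>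
    (add_le_add_right (uIcc_zero_abs_le hβ) _).trans_lt h
  have cint : ContinuousOn (fun p : ℝ × ℝ => q (p.1 + p.2) * F p) D :=
    (hq.comp (by fun_prop) fun p hp => (mD hp).1).mul cF.continuousOn
  have Fv : ∀ {u v : ℝ}, |u| + |v| < a →
      partialD 1 F (u, v) = ∫ α in (0 : ℝ)..u, q (α + v) * F (α, v) := by
    intro u v h
    have e := integral_eq_sub_of_hasDerivAt (a := 0) (b := u)
      (f := fun u => partialD 1 F (u, v)) (f' := fun α => q (α + v) * F (α, v))
      (fun α hα => by
        have := hK.pde α v (mD (sub1 h α hα)).1 (mD (sub1 h α hα)).2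
        simpa only [partialD_one] using this)
      (ContinuousOn.intervalIntegrable (cint.comp (by fun_prop) fun α hα => sub1 h α hα))
    -- The line u = 0 is the antidiagonal, where K vanishes identically; hence no constant of
    -- integration appears.
    have z : partialD 1 F (0, v) = 0 := by
      have hv : |v| < a := by linarith [abs_nonneg u]
      rw [partialD_one]
      have : (fun s => F (0, s)) =ᶠ[𝓝 v] fun _ => 0 := by
        filter_upwards [isOpen_Ioo.mem_nhds (abs_lt.1 hv)] with s hs
        simpa [hF] using hK.antidiag s hs
      rw [this.deriv_eq]
      simp
    rw [e, z, sub_zero]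
  have e := integral_eq_sub_of_hasDerivAt (a := 0) (b := v)
    (f := fun v => F (u, v)) (f' := fun β => partialD 1 F (u, β))
    (fun β hβ => dF (u, β) (sub2 huv β hβ))
    (ContinuousOn.intervalIntegrable (cFv.comp (by fun_prop) fun β hβ => sub2 huv β hβ))
  have hu : |u| < a := by linarith [abs_nonneg v]
  have e0 : F (u, 0) = 1 / 2 * ∫ s in (0 : ℝ)..u, q s := by
    simpa [hF] using hK.diag u (abs_lt.1 hu)
  have e1 : ∫ β in (0 : ℝ)..v, partialD 1 F (u, β)
      = ∫ β in (0 : ℝ)..v, ∫ α in (0 : ℝ)..u, q (α + β) * K (α + β) (α - β) :=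
    integral_congr fun β hβ => Fv (sub2 huv β hβ)
  rw [← e1, e, e0]
  simp [hF]

/-! ### Solvability of the Goursat problem and identification of the kernels -/

section

variable {a : ℝ} {χ : ℝ → ℝ}

theorem potential_eq_of_extension {r : ℝ} {ψ : ℝ → ℝ} (h : ∀ x ∈ Icc (-r) r, ψ x = χ x) {s : ℝ}
    (hs : |s| < r) : potential ψ s = potential χ s :=
  potential_congr (eventuallyEq_of_eq_on_Icc h (abs_lt.1 hs))

theorem goursat_unique_potential {W₁ W₂ : ℝ → ℝ → ℝ} {u v : ℝ}
    (hχ : ContDiffOn ℝ 2 χ (Ioo (-a) a)) (huv : |u| + |v| < a)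
    (c₁ : ContinuousOn (Function.uncurry W₁) {p : ℝ × ℝ | |p.1| + |p.2| < a})
    (h₁ : ∀ u' v', |u'| + |v'| ≤ |u| + |v| → W₁ u' v' = 1 / 2 * (∫ s in (0 : ℝ)..u', potential χ s)
      + ∫ β in (0 : ℝ)..v', ∫ α in (0 : ℝ)..u', potential χ (α + β) * W₁ α β)
    {ψ : ℝ → ℝ} {r : ℝ} (hψ : ∀ x ∈ Icc (-r) r, ψ x = χ x) (hr : |u| + |v| < r)
    (h₂ : IsGoursatIntegral (potential ψ)
      (fun u => 1 / 2 * ∫ s in (0 : ℝ)..u, potential ψ s) W₂) :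
    W₁ u v = W₂ u v := by
  refine goursat_unique (r := |u| + |v|)
    ((continuousOn_potential hχ).mono fun s hs => ⟨by linarith [hs.1], by linarith [hs.2]⟩)
    (c₁.mono fun p hp => lt_of_le_of_lt hp huv) h₂.cont.continuousOn h₁ (fun u' v' h =>
      h₂.eq_of_eqOn (fun s hs => potential_eq_of_extension hψ (hs.trans_lt hr)) h) le_rfl

theorem exists_local_goursat (hχ : ContDiffOn ℝ 2 χ (Ioo (-a) a)) {r : ℝ} (hr : 0 < r)
    (hra : r < a) : ∃ ψ W, ContDiff ℝ 2 ψ ∧ (∀ x ∈ Icc (-r) r, ψ x = χ x) ∧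
      IsGoursatIntegral (potential ψ) (fun u => 1 / 2 * ∫ s in (0 : ℝ)..u, potential ψ s) W := by
  obtain ⟨ψ, h1, h2, h3⟩ := exists_contDiff_extension hr hra hχ
  obtain ⟨W, hW⟩ := exists_goursat_of_hasCompactSupport h1 h2
  exact ⟨ψ, W, h1, h3, hW⟩

theorem IsGoursatIntegral.contDiff_one {q g g' : ℝ → ℝ} {W : ℝ → ℝ → ℝ}
    (h : IsGoursatIntegral q g W) (hq : Continuous q) (hg : ∀ u, HasDerivAt g (g' u) u)
    (hg' : Continuous g') : ContDiff ℝ 1 fun p : ℝ × ℝ => W p.1 p.2 := by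
  have := contDiff_succ_of_partials (n := 0) (f := fun p : ℝ × ℝ => W p.1 p.2)
    (fun p => h.hasDerivAt_fst hq hg p.1 p.2) (fun p => h.hasDerivAt_snd hq p.1 p.2)
    (contDiff_zero.2 (h.continuous_deriv_fst hq hg')) (contDiff_zero.2 (h.continuous_deriv_snd hq))
  simpa using this

theorem half_sum_abs (x t : ℝ) : |(x + t) / 2| + |(x - t) / 2| = max |x| |t| := by
  rw [abs_div, abs_div, abs_two, ← add_div]
  rcases le_total |x| |t| with h | h <;> [rw [max_eq_right h]; rw [max_eq_left h]] <;>
  rcases abs_cases x with ⟨h1, _⟩ | ⟨h1, _⟩ <;> rcases abs_cases t with ⟨h2, _⟩ | ⟨h2, _⟩ <;>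
  rcases abs_cases (x + t) with ⟨h3, _⟩ | ⟨h3, _⟩ <;>
  rcases abs_cases (x - t) with ⟨h4, _⟩ | ⟨h4, _⟩ <;>
  rw [h1, h2] at h <;> rw [h3, h4] <;> linarith

/-- The Goursat problem for a potential that is continuous on an open interval is solvable. -/
theorem exists_isGoursatSolution (ha : 0 < a) (hχ : ContDiffOn ℝ 2 χ (Ioo (-a) a)) :
    ∃ K, IsGoursatSolution a (potential χ) K := by
  have ex : ∀ r : ℝ, ∃ ψ W, 0 < r → r < a → ContDiff ℝ 2 ψ ∧ (∀ x ∈ Icc (-r) r, ψ x = χ x) ∧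
      IsGoursatIntegral (potential ψ) (fun u => 1 / 2 * ∫ s in (0 : ℝ)..u, potential ψ s) W := by
    intro r
    by_cases h : 0 < r ∧ r < a
    · obtain ⟨ψ, W, hW⟩ := exists_local_goursat hχ h.1 h.2
      exact ⟨ψ, W, fun _ _ => hW⟩
    · exact ⟨0, 0, fun h1 h2 => absurd ⟨h1, h2⟩ h⟩
  choose ψ W hW using ex
  -- The radius depends on the point: the midpoint between max |x| |t| and a exceeds the former and
  -- stays below the latter.
  set K : ℝ → ℝ → ℝ := fun x t => W ((max |x| |t| + a) / 2) ((x + t) / 2) ((x - t) / 2) with hK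
  -- By uniqueness the choice of radius is immaterial, so near each point K coincides with one fixed
  -- `W r` and inherits its regularity and equation.
  have key : ∀ {r u v : ℝ}, 0 < r → r < a → |u| + |v| < r → K (u + v) (u - v) = W r u v := by
    intro r u v hr hra huv
    have hm : max |u + v| |u - v| = |u| + |v| := by
      rw [← half_sum_abs]
      congr 2 <;> ring
    have e : K (u + v) (u - v) = W ((|u| + |v| + a) / 2) u v := by
      simp only [hK, hm]
      congr 1 <;> ring
    have h0 : 0 ≤ |u| + |v| := by positivity
    obtain ⟨-, h2, h3⟩ := hW ((|u| + |v| + a) / 2) (by linarith) (by linarith)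
    obtain ⟨-, h2', h3'⟩ := hW r hr hra
    rw [e]
    exact goursat_unique_potential hχ (huv.trans hra) h3.cont.continuousOn
      (fun u' v' h => h3.eq_of_eqOn
        (fun s hs => potential_eq_of_extension h2 (hs.trans_lt (by linarith))) h) h2' huv h3'
  have key' : ∀ {r : ℝ}, 0 < r → r < a → ∀ x ∈ Ioo (-r) r, ∀ t ∈ Ioo (-r) r,
      K x t = W r ((x + t) / 2) ((x - t) / 2) := by
    intro r hr hra x hx t ht
    rw [← key hr hra (by
      rw [half_sum_abs]
      exact max_lt (abs_lt.2 hx) (abs_lt.2 ht))]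
    congr 1 <;> ring
  have rad : ∀ {u v : ℝ}, |u| + |v| < a → ∃ r, 0 < r ∧ r < a ∧ |u| + |v| < r := fun {u v} h => by
    have h0 : 0 ≤ |u| + |v| := by positivity
    exact ⟨(|u| + |v| + a) / 2, by linarith, by linarith, by linarith⟩
  refine ⟨K, ⟨?_, ?_, ?_, ?_⟩⟩
  · rintro ⟨x, t⟩ ⟨hx, ht⟩
    have hm : max |x| |t| < a := max_lt (abs_lt.2 hx) (abs_lt.2 ht)
    rw [← half_sum_abs] at hm
    obtain ⟨r, hr, hra, hlt⟩ := rad hm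
    rw [half_sum_abs, max_lt_iff] at hlt
    obtain ⟨h1, -, h3⟩ := hW r hr hra
    have cq := continuous_potential h1
    have cW := h3.contDiff_one (g' := fun u => 1 / 2 * potential (ψ r) u) cq
      (fun u => (hasDerivAt_primitive cq 0 u).const_mul _) (by fun_prop)
    have cW' : ContDiff ℝ 1 fun p : ℝ × ℝ => W r ((p.1 + p.2) / 2) ((p.1 - p.2) / 2) :=
      cW.comp (g := fun p : ℝ × ℝ => W r p.1 p.2)
        (f := fun p : ℝ × ℝ => ((p.1 + p.2) / 2, (p.1 - p.2) / 2)) (by fun_prop)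
    refine ContDiffAt.contDiffWithinAt (cW'.contDiffAt.congr_of_eventuallyEq ?_)
    filter_upwards [(isOpen_Ioo.prod isOpen_Ioo).mem_nhds
      (⟨abs_lt.1 hlt.1, abs_lt.1 hlt.2⟩ : (x, t) ∈ Ioo (-r) r ×ˢ Ioo (-r) r)] with p hp
    exact key' hr hra _ hp.1 _ hp.2
  · intro u v h1 h2
    obtain ⟨r, hr, hra, hlt⟩ := rad (mem_diamond_iff.1 ⟨h1, h2⟩)
    obtain ⟨h1, h2, h3⟩ := hW r hr hra
    have cq := continuous_potential h1
    have oD : IsOpen {p : ℝ × ℝ | |p.1| + |p.2| < r} := isOpen_lt (by fun_prop) continuous_const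
    have ev : (fun u' => deriv (fun v' => K (u' + v') (u' - v')) v)
        =ᶠ[𝓝 u] fun u' => ∫ α in (0 : ℝ)..u', potential (ψ r) (α + v) * W r α v := by
      have n1 : ∀ᶠ u' in 𝓝 u, |u'| + |v| < r :=
        (isOpen_lt (by fun_prop) continuous_const).mem_nhds hlt
      filter_upwards [n1] with u' hu'
      have n2 : ∀ᶠ v' in 𝓝 v, |u'| + |v'| < r :=
        (isOpen_lt (by fun_prop) continuous_const).mem_nhds hu'
      have e2 : (fun v' => K (u' + v') (u' - v')) =ᶠ[𝓝 v] fun v' => W r u' v' := by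
        filter_upwards [n2] with v' hv' using key hr hra hv'
      rw [e2.deriv_eq]
      exact (h3.hasDerivAt_snd cq u' v).deriv
    refine ((h3.hasDerivAt_deriv_snd cq u v).congr_of_eventuallyEq ev).congr_deriv ?_
    rw [key hr hra hlt, potential_eq_of_extension h2 ((abs_add_le _ _).trans_lt hlt)]
  · intro x hx
    obtain ⟨r, hr, hra, hlt⟩ := rad (u := x) (v := 0) (by simpa using abs_lt.2 hx)
    have := key hr hra hlt
    obtain ⟨h1, h2, h3⟩ := hW r hr hra
    rw [add_zero, sub_zero, h3.eq_of_eqOn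
      (fun s hs => potential_eq_of_extension h2 (hs.trans_lt hlt)) le_rfl] at this
    simpa using this
  · intro x hx
    obtain ⟨r, hr, hra, hlt⟩ := rad (u := 0) (v := x) (by simpa using abs_lt.2 hx)
    have := key hr hra hlt
    obtain ⟨h1, h2, h3⟩ := hW r hr hra
    rw [zero_add, zero_sub, h3.eq] at this
    simpa using this

/-- Existence makes the chosen `kernelK` a genuine solution; uniqueness on the diamond then compares
it with the solution for the extended superpotential. -/
theorem kernelK_eq (ha : 0 < a) (hχ : ContDiffOn ℝ 2 χ (Ioo (-a) a)) {ψ : ℝ → ℝ} {r : ℝ}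
    (hra : r < a) (hψ : ∀ x ∈ Icc (-r) r, ψ x = χ x) {W : ℝ → ℝ → ℝ}
    (hW : IsGoursatIntegral (potential ψ)
      (fun u => 1 / 2 * ∫ s in (0 : ℝ)..u, potential ψ s) W)
    {x t : ℝ} (hx : x ∈ Ioo (-r) r) (ht : t ∈ Ioo (-r) r) :
    kernelK a χ x t = W ((x + t) / 2) ((x - t) / 2) := by
  have hK : IsGoursatSolution a (potential χ) (kernelK a χ) :=
    Classical.epsilon_spec (exists_isGoursatSolution ha hχ)
  have hr : |(x + t) / 2| + |(x - t) / 2| < r := by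
    rw [half_sum_abs]
    exact max_lt (abs_lt.2 hx) (abs_lt.2 ht)
  have := goursat_unique_potential (W₁ := fun u v => kernelK a χ (u + v) (u - v)) hχ
    (hr.trans hra)
    (hK.contDiffOn.continuousOn.comp (f := fun p : ℝ × ℝ => (p.1 + p.2, p.1 - p.2))
      (by fun_prop) fun p hp => mem_diamond_iff.2 hp)
    (fun u v h => hK.integral_eq (continuousOn_potential hχ) (h.trans_lt (hr.trans hra))) hψ hr hW
  rw [← this]
  congr 1 <;> ring

/-- On compact subintervals, the kernels `𝐊` and `𝐊~` form a Darboux pair. -/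
theorem exists_isDarbouxPair_kernel (hχ : ContDiffOn ℝ 2 χ (Ioo (-a) a)) (hχ0 : χ 0 = 0) {r : ℝ}
    (hr : 0 < r) (hra : r < a) : ∃ ψ : ℝ → ℝ, ContDiff ℝ 2 ψ ∧ (∀ x ∈ Icc (-r) r, ψ x = χ x) ∧
      ∃ b k l kt lt, IsDarbouxPair (deriv ψ) b k l kt lt ∧
        ∀ x ∈ Ioo (-r) r, ∀ t ∈ Ioo (-r) r,
          kernelKh a χ x t = k x t ∧ kernelKtilde a χ x t = l x t := by
  obtain ⟨ψ, W, h1, h2, h3⟩ := exists_local_goursat hχ hr hra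
  have z : (0 : ℝ) ∈ Icc (-r) r := ⟨by linarith, hr.le⟩
  have hh : hConst χ = deriv ψ 0 := by
    have e : (fun x => Real.exp (χ x)) =ᶠ[𝓝 0] fun x => Real.exp (ψ x) := by
      filter_upwards [eventuallyEq_of_eq_on_Icc h2 ⟨neg_lt_zero.2 hr, hr⟩] with x hx
      rw [hx]
    rw [hConst, e.deriv_eq, (hasDerivAt_of_contDiff_two h1 0).exp.deriv, h2 0 z, hχ0]
    simp
  obtain ⟨l, kt, lt, hp⟩ := exists_isDarbouxPair h1 ((h2 0 z).trans hχ0)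
    (h3.shift (continuous_potential h1) (deriv ψ 0))
  have hk : ∀ x ∈ Ioo (-r) r, ∀ t ∈ Ioo (-r) r, kernelKh a χ x t
      = deriv ψ 0 / 2 + W ((x + t) / 2) ((x - t) / 2)
        + deriv ψ 0 / 2 * oddPrimitive W ((x + t) / 2 + (x - t) / 2)
          ((x + t) / 2 - (x - t) / 2) := by
    intro x hx t ht
    rw [show (x + t) / 2 + (x - t) / 2 = x by ring, show (x + t) / 2 - (x - t) / 2 = t by ring,
      kernelKh, hh, kernelK_eq (hr.trans hra) hχ hra h2 h3 hx ht, oddPrimitive]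
    congr 2
    refine integral_congr fun s hs => ?_
    have hs' : s ∈ Ioo (-r) r := ordConnected_Ioo.uIcc_subset ht hx hs
    have hs'' : -s ∈ Ioo (-r) r := ⟨by linarith [hs'.2], by linarith [hs'.1]⟩
    rw [kernelK_eq (hr.trans hra) hχ hra h2 h3 hx hs',
      kernelK_eq (hr.trans hra) hχ hra h2 h3 hx hs'',
      sub_neg_eq_add, ← sub_eq_add_neg]
  refine ⟨ψ, h1, h2, _, _, l, kt, lt, hp, fun x hx t ht => ⟨hk x hx t ht, ?_⟩⟩
  have ht' : -t ∈ Ioo (-r) r := ⟨by linarith [ht.2], by linarith [ht.1]⟩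
  rw [hp.second_kernel_eq h1, kernelKtilde, hh, h2 x (Ioo_subset_Icc_self hx),
    h2 _ (Ioo_subset_Icc_self ht')]
  congr 2
  refine integral_congr fun s hs => ?_
  have hs' : s ∈ Ioo (-r) r := ordConnected_Ioo.uIcc_subset ht' hx hs
  -- The kernel 𝐊~ contains ∂_t 𝐊, so equality of the kernels is needed on a neighbourhood of t, not
  -- just at t.
  have e := eventually_of_mem (isOpen_Ioo.mem_nhds ht) fun τ hτ => hk s hs' τ hτ
  rw [EventuallyEq.deriv_eq e, (hp.deriv_t_k s t).deriv, h2 s (Ioo_subset_Icc_self hs')]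

end

/-! ### Locality of the differential operators -/

section locality

variable {p : ℝ × ℝ}

theorem partialD_congr {E : Type*} [NormedAddCommGroup E] [NormedSpace ℝ E] {f g : ℝ × ℝ → E}
    (h : f =ᶠ[𝓝 p] g) (i : Fin 2) : partialD i f p = partialD i g p := by
  have h1 : (fun s => f (s, p.2)) =ᶠ[𝓝 p.1] fun s => g (s, p.2) :=
    (by fun_prop : ContinuousAt (fun s => (s, p.2)) p.1).eventually h
  have h2 : (fun s => f (p.1, s)) =ᶠ[𝓝 p.2] fun s => g (p.1, s) :=
    (by fun_prop : ContinuousAt (fun s => (p.1, s)) p.2).eventually h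
  rw [partialD, partialD, h1.deriv_eq, h2.deriv_eq]

theorem eventuallyEq_partialD {E : Type*} [NormedAddCommGroup E] [NormedSpace ℝ E]
    {f g : ℝ × ℝ → E} (h : f =ᶠ[𝓝 p] g) (i : Fin 2) : partialD i f =ᶠ[𝓝 p] partialD i g :=
  h.eventually_nhds.mono fun _ hq => partialD_congr hq i

theorem laplace_congr {E : Type*} [NormedAddCommGroup E] [NormedSpace ℝ E] {f g : ℝ × ℝ → E}
    (h : f =ᶠ[𝓝 p] g) : laplace f p = laplace g p :=
  Finset.sum_congr rfl fun k _ => partialD_congr (eventuallyEq_partialD h k) k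

variable {χ χ' f f' : ℝ × ℝ → ℝ}

theorem eventuallyEq_qPlus (hχ : χ =ᶠ[𝓝 p] χ') (h : f =ᶠ[𝓝 p] f') (i : Fin 2) :
    qPlus χ i f =ᶠ[𝓝 p] qPlus χ' i f' := by
  filter_upwards [eventuallyEq_partialD hχ i, eventuallyEq_partialD h i, h] with q h1 h2 h3
  rw [qPlus, qPlus, h1, h2, h3]

theorem eventuallyEq_qMinus (hχ : χ =ᶠ[𝓝 p] χ') (h : f =ᶠ[𝓝 p] f') (i : Fin 2) :
    qMinus χ i f =ᶠ[𝓝 p] qMinus χ' i f' := by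
  filter_upwards [eventuallyEq_partialD hχ i, eventuallyEq_partialD h i, h] with q h1 h2 h3
  rw [qMinus, qMinus, h1, h2, h3]

theorem eventuallyEq_pPlus (hχ : χ =ᶠ[𝓝 p] χ') (h : f =ᶠ[𝓝 p] f') (i : Fin 2) :
    pPlus χ i f =ᶠ[𝓝 p] pPlus χ' i f' := by
  filter_upwards [eventuallyEq_qMinus hχ h 0, eventuallyEq_qMinus hχ h 1] with q h1 h2
  rw [pPlus, pPlus, Fin.sum_univ_two, Fin.sum_univ_two, h1, h2]

theorem eventuallyEq_pMinus (hχ : χ =ᶠ[𝓝 p] χ') (h : f =ᶠ[𝓝 p] f') (i : Fin 2) :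
    pMinus χ i f =ᶠ[𝓝 p] pMinus χ' i f' := by
  filter_upwards [eventuallyEq_qPlus hχ h 0, eventuallyEq_qPlus hχ h 1] with q h1 h2
  rw [pMinus, pMinus, Fin.sum_univ_two, Fin.sum_univ_two, h1, h2]

theorem H0_congr (hχ : χ =ᶠ[𝓝 p] χ') (h : f =ᶠ[𝓝 p] f') : H0 χ f p = H0 χ' f' p :=
  Finset.sum_congr rfl fun k _ =>
    (eventuallyEq_qPlus hχ (eventuallyEq_qMinus hχ h k) k).eq_of_nhds

theorem H2_congr (hχ : χ =ᶠ[𝓝 p] χ') (h : f =ᶠ[𝓝 p] f') : H2 χ f p = H2 χ' f' p :=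
  Finset.sum_congr rfl fun k _ =>
    (eventuallyEq_pPlus hχ (eventuallyEq_pMinus hχ h k) k).eq_of_nhds

theorem H1_congr {Φ Φ' : Fin 2 → ℝ × ℝ → ℝ} (hχ : χ =ᶠ[𝓝 p] χ')
    (h : ∀ j, Φ j =ᶠ[𝓝 p] Φ' j) (i : Fin 2) : H1 χ Φ i p = H1 χ' Φ' i p :=
  Finset.sum_congr rfl fun j _ => congrArg₂ (· + ·)
    (eventuallyEq_qMinus hχ (eventuallyEq_qPlus hχ (h j) j) i).eq_of_nhds
    (eventuallyEq_pMinus hχ (eventuallyEq_pPlus hχ (h j) j) i).eq_of_nhds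

end locality

theorem uIcc_neg_subset_Ioo {x r : ℝ} (hx : x ∈ Ioo (-r) r) : uIcc (-x) x ⊆ Ioo (-r) r :=
  ordConnected_Ioo.uIcc_subset ⟨by linarith [hx.2], by linarith [hx.1]⟩ hx

theorem volterra_congr {k k' : ℝ → ℝ → ℝ} {f g : ℝ → ℝ} {r x : ℝ}
    (hk : ∀ x ∈ Ioo (-r) r, ∀ t ∈ Ioo (-r) r, k x t = k' x t)
    (hf : ∀ t ∈ Ioo (-r) r, f t = g t) (hx : x ∈ Ioo (-r) r) :
    volterra k f x = volterra k' g x := by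
  rw [volterra, volterra, hf x hx]
  congr 1
  refine integral_congr fun t ht => ?_
  have ht' := uIcc_neg_subset_Ioo hx ht
  simp only [hk x hx t ht', hf t ht']

/-- The value at p uses only points of the closed rectangle with vertices (±p.1, ±p.2), which stays
inside the symmetric open rectangle. -/
theorem planeVolterra_congr {k k' m m' : ℝ → ℝ → ℝ} {f g : ℝ × ℝ → ℝ} {r₁ r₂ : ℝ}
    (hk : ∀ x ∈ Ioo (-r₁) r₁, ∀ t ∈ Ioo (-r₁) r₁, k x t = k' x t)
    (hm : ∀ x ∈ Ioo (-r₂) r₂, ∀ t ∈ Ioo (-r₂) r₂, m x t = m' x t)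
    (hf : ∀ p ∈ Ioo (-r₁) r₁ ×ˢ Ioo (-r₂) r₂, f p = g p) {p : ℝ × ℝ}
    (hp : p ∈ Ioo (-r₁) r₁ ×ˢ Ioo (-r₂) r₂) :
    planeVolterra k m f p = planeVolterra k' m' g p :=
  volterra_congr hk (fun s hs => volterra_congr hm (fun t ht => hf (s, t) ⟨hs, ht⟩) hp.2) hp.1

/-! ### Complex-valued functions -/

theorem partialD_re {f : ℝ × ℝ → ℂ} (hf : Differentiable ℝ f) (i : Fin 2) (p : ℝ × ℝ) :
    (partialD i f p).re = partialD i (fun q => (f q).re) p := by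
  have h1 : DifferentiableAt ℝ (fun s => f (s, p.2)) p.1 := by fun_prop
  have h2 : DifferentiableAt ℝ (fun s => f (p.1, s)) p.2 := by fun_prop
  have e1 := (Complex.reCLM.hasFDerivAt.comp_hasDerivAt p.1 h1.hasDerivAt).deriv
  have e2 := (Complex.reCLM.hasFDerivAt.comp_hasDerivAt p.2 h2.hasDerivAt).deriv
  rw [partialD, partialD]
  split_ifs
  · exact e1.symm
  · exact e2.symm

theorem partialD_im {f : ℝ × ℝ → ℂ} (hf : Differentiable ℝ f) (i : Fin 2) (p : ℝ × ℝ) :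
    (partialD i f p).im = partialD i (fun q => (f q).im) p := by
  have h1 : DifferentiableAt ℝ (fun s => f (s, p.2)) p.1 := by fun_prop
  have h2 : DifferentiableAt ℝ (fun s => f (p.1, s)) p.2 := by fun_prop
  have e1 := (Complex.imCLM.hasFDerivAt.comp_hasDerivAt p.1 h1.hasDerivAt).deriv
  have e2 := (Complex.imCLM.hasFDerivAt.comp_hasDerivAt p.2 h2.hasDerivAt).deriv
  rw [partialD, partialD]
  split_ifs
  · exact e1.symm
  · exact e2.symm

theorem differentiable_partialD_complex {f : ℝ × ℝ → ℂ} (hf : ContDiff ℝ 2 f) (i : Fin 2) :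
    Differentiable ℝ (partialD i f) := by
  have hd : Differentiable ℝ f := hf.differentiable (by simp)
  have e : partialD i f = fun p =>
      ((partialD i (fun q => (f q).re) p : ℝ) : ℂ)
        + (partialD i (fun q => (f q).im) p : ℝ) * Complex.I := by
    funext p
    rw [← partialD_re hd, ← partialD_im hd, Complex.re_add_im]
  have h1 : Differentiable ℝ (partialD i fun q => (f q).re) :=
    (contDiff_one_partialD_of_two (Complex.reCLM.contDiff.comp hf) i).differentiable (by simp)
  have h2 : Differentiable ℝ (partialD i fun q => (f q).im) :=
    (contDiff_one_partialD_of_two (Complex.imCLM.contDiff.comp hf) i).differentiable (by simp)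
  rw [e]
  exact (Complex.ofRealCLM.differentiable.comp h1).add
    ((Complex.ofRealCLM.differentiable.comp h2).mul_const _)

theorem laplace_re {f : ℝ × ℝ → ℂ} (hf : ContDiff ℝ 2 f) (p : ℝ × ℝ) :
    (laplace f p).re = laplace (fun q => (f q).re) p := by
  simp only [laplace, Complex.re_sum, partialD_re (differentiable_partialD_complex hf _),
    partialD_re (hf.differentiable (by simp))]

theorem laplace_im {f : ℝ × ℝ → ℂ} (hf : ContDiff ℝ 2 f) (p : ℝ × ℝ) :
    (laplace f p).im = laplace (fun q => (f q).im) p := by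
  simp only [laplace, Complex.im_sum, partialD_im (differentiable_partialD_complex hf _),
    partialD_im (hf.differentiable (by simp))]

/-! ### Localization to rectangles -/

theorem exists_rect {Ω : Set (ℝ × ℝ)} (hΩ : IsOpen Ω) (hs : IsRectSymmetric Ω) {p : ℝ × ℝ}
    (hp : p ∈ Ω) : ∃ r₁ r₂ R₁ R₂ : ℝ, 0 < r₁ ∧ 0 < r₂ ∧ r₁ < R₁ ∧ r₂ < R₂ ∧
      p ∈ Ioo (-r₁) r₁ ×ˢ Ioo (-r₂) r₂ ∧ Icc (-R₁) R₁ ×ˢ Icc (-R₂) R₂ ⊆ Ω := by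
  -- Moving the reflected corner outwards by ε/2 stays in Ω and yields the outer rectangle. The
  -- offset ε/4 gives the inner one, leaving room for a cutoff and keeping both radii positive on
  -- the axes.
  have h0 : (|p.1|, |p.2|) ∈ Ω := hs p hp _ _ (abs_abs _).le (abs_abs _).le
  obtain ⟨ε, hε, hb⟩ := Metric.isOpen_iff.1 hΩ _ h0
  have h1 : (|p.1| + ε / 2, |p.2| + ε / 2) ∈ Ω := by
    apply hb
    rw [Metric.mem_ball, Prod.dist_eq, Real.dist_eq, Real.dist_eq, add_sub_cancel_left,
      add_sub_cancel_left, max_self, abs_of_pos (by linarith)]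
    linarith
  have n1 := abs_nonneg p.1
  have n2 := abs_nonneg p.2
  refine ⟨|p.1| + ε / 4, |p.2| + ε / 4, |p.1| + ε / 2, |p.2| + ε / 2, by linarith, by linarith,
    by linarith, by linarith, ⟨abs_lt.1 (by linarith), abs_lt.1 (by linarith)⟩, ?_⟩
  rintro ⟨s, t⟩ ⟨hs', ht'⟩
  refine hs _ h1 s t ?_ ?_
  · rw [abs_of_nonneg (a := |p.1| + ε / 2) (by linarith)]
    exact abs_le.2 hs'
  · rw [abs_of_nonneg (a := |p.2| + ε / 2) (by linarith)]
    exact abs_le.2 ht'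

theorem exists_contDiff_extension_rect {F : Type*} [NormedAddCommGroup F] [NormedSpace ℝ F]
    {Ω : Set (ℝ × ℝ)} {w : ℝ × ℝ → F} (hw : ContDiffOn ℝ 2 w Ω) {r₁ r₂ R₁ R₂ : ℝ}
    (h₁ : 0 < r₁) (h₂ : 0 < r₂) (hR₁ : r₁ < R₁) (hR₂ : r₂ < R₂)
    (hR : Icc (-R₁) R₁ ×ˢ Icc (-R₂) R₂ ⊆ Ω) :
    ∃ w' : ℝ × ℝ → F, ContDiff ℝ 2 w' ∧
      ∀ p ∈ Ioo (-r₁) r₁ ×ˢ Ioo (-r₂) r₂, w p = w' p := by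
  obtain ⟨φ₁, c₁, e₁, s₁, -⟩ := exists_cutoff h₁ hR₁
  obtain ⟨φ₂, c₂, e₂, s₂, -⟩ := exists_cutoff h₂ hR₂
  refine ⟨fun p => (φ₁ p.1 * φ₂ p.2) • w p, contDiff_smul_of_tsupport_subset (n := 2)
    (isOpen_Ioo.prod isOpen_Ioo) (hw.mono ((Set.prod_mono Ioo_subset_Icc_self
      Ioo_subset_Icc_self).trans hR)) ((c₁.comp contDiff_fst).mul (c₂.comp contDiff_snd)) ?_,
    fun p hp => ?_⟩
  · refine (closure_minimal (t := tsupport φ₁ ×ˢ tsupport φ₂) (fun p hp => ?_)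
      ((isClosed_tsupport _).prod (isClosed_tsupport _))).trans (Set.prod_mono s₁ s₂)
    exact ⟨subset_tsupport _ (left_ne_zero_of_mul hp), subset_tsupport _ (right_ne_zero_of_mul hp)⟩
  · simp [e₁ _ (Ioo_subset_Icc_self hp.1), e₂ _ (Ioo_subset_Icc_self hp.2)]

theorem contDiff_complex {A B : ℝ × ℝ → ℝ} (hA : ContDiff ℝ 2 A) (hB : ContDiff ℝ 2 B) :
    ContDiff ℝ 2 fun p => (A p : ℂ) + Complex.I * (B p : ℂ) :=
  (Complex.ofRealCLM.contDiff.comp hA).add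
    (contDiff_const.mul (Complex.ofRealCLM.contDiff.comp hB))

/-- On a small symmetric rectangle around p, the superpotentials, kernels and w are replaced by
globally defined ones. The operators do not see the difference there, so the global identities give
the claim at p. -/
theorem transmutation_at {a₁ a₂ : ℝ} {χ₁ χ₂ : ℝ → ℝ}
    (hχ₁ : ContDiffOn ℝ 2 χ₁ (Ioo (-a₁) a₁)) (hχ₂ : ContDiffOn ℝ 2 χ₂ (Ioo (-a₂) a₂))
    (hχ₁0 : χ₁ 0 = 0) (hχ₂0 : χ₂ 0 = 0) {Ω : Set (ℝ × ℝ)} (hΩ : IsOpen Ω)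
    (hΩR : Ω ⊆ Icc (-a₁) a₁ ×ˢ Icc (-a₂) a₂) (hΩsymm : IsRectSymmetric Ω)
    {χ : ℝ × ℝ → ℝ} (hχ : ∀ p, χ p = χ₁ p.1 + χ₂ p.2)
    {w : ℝ × ℝ → ℂ} (hw : ContDiffOn ℝ 2 w Ω) {p : ℝ × ℝ} (hp : p ∈ Ω) :
    (ContDiffAt ℝ 2 (bT0 a₁ a₂ χ₁ χ₂ w) p ∧
      ∀ i : Fin 2, H χ (P (bT0 a₁ a₂ χ₁ χ₂ w)) i p = -P (bT0 a₁ a₂ χ₁ χ₂ (laplace w)) i p) ∧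
    (ContDiffAt ℝ 2 (bT1 a₁ a₂ χ₁ χ₂ w) p ∧
      ∀ i : Fin 2, H1 χ (P (bT1 a₁ a₂ χ₁ χ₂ w)) i p = -P (bT1 a₁ a₂ χ₁ χ₂ (laplace w)) i p) := by
  obtain ⟨r₁, r₂, R₁, R₂, hr₁, hr₂, hR₁, hR₂, hpU, hR⟩ := exists_rect hΩ hΩsymm hp
  -- The corner (R₁, R₂) lies in Ω, so R_j ≤ a_j and hence r_j < a_j, as the local kernel
  -- construction requires.
  have hmem := hΩR (hR (⟨⟨by linarith, le_rfl⟩, by linarith, le_rfl⟩ :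
    (R₁, R₂) ∈ Icc (-R₁) R₁ ×ˢ Icc (-R₂) R₂))
  obtain ⟨ψ₁, hψ₁, e₁, b₁, k₁, l₁, kt₁, lt₁, h₁, hk₁⟩ :=
    exists_isDarbouxPair_kernel hχ₁ hχ₁0 hr₁ (hR₁.trans_le hmem.1.2)
  obtain ⟨ψ₂, hψ₂, e₂, b₂, k₂, l₂, kt₂, lt₂, h₂, hk₂⟩ :=
    exists_isDarbouxPair_kernel hχ₂ hχ₂0 hr₂ (hR₂.trans_le hmem.2.2)
  obtain ⟨w', hw', ew⟩ := exists_contDiff_extension_rect hw hr₁ hr₂ hR₁ hR₂ hR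
  set U : Set (ℝ × ℝ) := Ioo (-r₁) r₁ ×ˢ Ioo (-r₂) r₂ with hU
  have oU : IsOpen U := isOpen_Ioo.prod isOpen_Ioo
  set u : ℝ × ℝ → ℝ := fun q => (w' q).re with hu
  set v : ℝ × ℝ → ℝ := fun q => (w' q).im with hv
  have cu : ContDiff ℝ 2 u := Complex.reCLM.contDiff.comp hw'
  have cv : ContDiff ℝ 2 v := Complex.imCLM.contDiff.comp hw'
  have eu : ∀ q ∈ U, (w q).re = u q := fun q hq => congrArg Complex.re (ew q hq)
  have ev : ∀ q ∈ U, (w q).im = v q := fun q hq => congrArg Complex.im (ew q hq)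
  have eL : ∀ q ∈ U, laplace w q = laplace w' q := fun q hq =>
    laplace_congr (Filter.eventually_of_mem (oU.mem_nhds hq) ew)
  have eLu : ∀ q ∈ U, (laplace w q).re = laplace u q := fun q hq => by
    rw [eL q hq, laplace_re hw']
  have eLv : ∀ q ∈ U, (laplace w q).im = laplace v q := fun q hq => by
    rw [eL q hq, laplace_im hw']
  have K₁ := fun x hx t ht => (hk₁ x hx t ht).1
  have L₁ := fun x hx t ht => (hk₁ x hx t ht).2
  have K₂ := fun x hx t ht => (hk₂ x hx t ht).1
  have L₂ := fun x hx t ht => (hk₂ x hx t ht).2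
  have B0 : ∀ {z : ℝ × ℝ → ℂ} {x y : ℝ × ℝ → ℝ}, (∀ q ∈ U, (z q).re = x q) →
      (∀ q ∈ U, (z q).im = y q) → ∀ q ∈ U, bT0 a₁ a₂ χ₁ χ₂ z q
        = (planeVolterra k₁ k₂ x q : ℂ) + Complex.I * (planeVolterra l₁ l₂ y q : ℂ) :=
    fun hx hy q hq => congrArg₂ (fun s t : ℝ => (s : ℂ) + Complex.I * (t : ℂ))
      (planeVolterra_congr K₁ K₂ hx hq) (planeVolterra_congr L₁ L₂ hy hq)
  have B1 : ∀ {z : ℝ × ℝ → ℂ} {x y : ℝ × ℝ → ℝ}, (∀ q ∈ U, (z q).re = x q) →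
      (∀ q ∈ U, (z q).im = y q) → ∀ q ∈ U, bT1 a₁ a₂ χ₁ χ₂ z q
        = (planeVolterra l₁ k₂ x q : ℂ) + Complex.I * (planeVolterra k₁ l₂ y q : ℂ) :=
    fun hx hy q hq => congrArg₂ (fun s t : ℝ => (s : ℂ) + Complex.I * (t : ℂ))
      (planeVolterra_congr L₁ K₂ hx hq) (planeVolterra_congr K₁ L₂ hy hq)
  have nU := oU.mem_nhds hpU
  have eχ : χ =ᶠ[𝓝 p] fun q => ψ₁ q.1 + ψ₂ q.2 := by
    filter_upwards [nU] with q hq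
    rw [hχ, e₁ _ (Ioo_subset_Icc_self hq.1), e₂ _ (Ioo_subset_Icc_self hq.2)]
  have d₁ := contDiff_one_deriv hψ₁
  have d₂ := contDiff_one_deriv hψ₂
  have PB : ∀ {z : ℝ × ℝ → ℂ} {A B : ℝ × ℝ → ℝ},
      (∀ q ∈ U, z q = (A q : ℂ) + Complex.I * (B q : ℂ)) →
      ∀ q ∈ U, ∀ j : Fin 2, P z j q = ![B, A] j q := by
    intro z A B h q hq j
    fin_cases j <;> simp [P, h q hq]
  have PBe : ∀ {z : ℝ × ℝ → ℂ} {A B : ℝ × ℝ → ℝ},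
      (∀ q ∈ U, z q = (A q : ℂ) + Complex.I * (B q : ℂ)) →
      ∀ j : Fin 2, P z j =ᶠ[𝓝 p] ![B, A] j := fun h j => by
    filter_upwards [nU] with q hq using PB h q hq j
  refine ⟨⟨?_, fun i => ?_⟩, ?_, fun i => ?_⟩
  · exact (contDiff_complex (contDiff_two_planeVolterra h₁ h₂ d₁ d₂ cu)
      (contDiff_two_planeVolterra h₁.symm h₂.symm d₁.neg d₂.neg cv)).contDiffAt
      |>.congr_of_eventuallyEq (Filter.eventually_of_mem nU (B0 eu ev))
  · rw [PB (B0 eLu eLv) p hpU]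
    fin_cases i
    · exact (H0_congr eχ (PBe (B0 eu ev) 0)).trans
        (H0_planeVolterra (fun _ => rfl) h₁ h₂ cv p)
    · exact (H2_congr eχ (PBe (B0 eu ev) 1)).trans
        (H2_planeVolterra (fun _ => rfl) h₁ h₂ cu p)
  · exact (contDiff_complex (contDiff_two_planeVolterra h₁.symm h₂ d₁.neg d₂ cu)
      (contDiff_two_planeVolterra h₁ h₂.symm d₁ d₂.neg cv)).contDiffAt
      |>.congr_of_eventuallyEq (Filter.eventually_of_mem nU (B1 eu ev))
  · rw [PB (B1 eLu eLv) p hpU, H1_congr eχ (PBe (B1 eu ev)) i]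
    fin_cases i
    · exact H1_planeVolterra_zero (fun _ => rfl) h₁ h₂ cu cv p
    · exact H1_planeVolterra_one (fun _ => rfl) h₁ h₂ cu cv p

end SUSY

end

theorem mainTheorem5 (a₁ a₂ : ℝ) (ha₁ : 0 < a₁) (ha₂ : 0 < a₂) (χ₁ χ₂ : ℝ → ℝ)
    (hχ₁ : ContDiffOn ℝ 2 χ₁ (Set.Ioo (-a₁) a₁)) (hχ₂ : ContDiffOn ℝ 2 χ₂ (Set.Ioo (-a₂) a₂))
    (hχ₁' : ContDiffOn ℝ 1 χ₁ (Set.Icc (-a₁) a₁)) (hχ₂' : ContDiffOn ℝ 1 χ₂ (Set.Icc (-a₂) a₂))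
    (hχ₁0 : χ₁ 0 = 0) (hχ₂0 : χ₂ 0 = 0)
    (Ω : Set (ℝ × ℝ)) (hΩ : IsOpen Ω)
    (hΩR : Ω ⊆ Set.Icc (-a₁) a₁ ×ˢ Set.Icc (-a₂) a₂) (hΩsymm : SUSY.IsRectSymmetric Ω)
    (χ : ℝ × ℝ → ℝ) (hχ : ∀ p, χ p = χ₁ p.1 + χ₂ p.2)
    (w : ℝ × ℝ → ℂ) (hw : ContDiffOn ℝ 2 w Ω) :
    (ContDiffOn ℝ 2 (SUSY.bT0 a₁ a₂ χ₁ χ₂ w) Ω ∧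
      ∀ p ∈ Ω, ∀ i : Fin 2,
        SUSY.H χ (SUSY.P (SUSY.bT0 a₁ a₂ χ₁ χ₂ w)) i p
          = -SUSY.P (SUSY.bT0 a₁ a₂ χ₁ χ₂ (SUSY.laplace w)) i p) ∧
    (ContDiffOn ℝ 2 (SUSY.bT1 a₁ a₂ χ₁ χ₂ w) Ω ∧
      ∀ p ∈ Ω, ∀ i : Fin 2,
        SUSY.H1 χ (SUSY.P (SUSY.bT1 a₁ a₂ χ₁ χ₂ w)) i p
          = -SUSY.P (SUSY.bT1 a₁ a₂ χ₁ χ₂ (SUSY.laplace w)) i p) := by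
  have main := fun p (hp : p ∈ Ω) =>
    SUSY.transmutation_at hχ₁ hχ₂ hχ₁0 hχ₂0 hΩ hΩR hΩsymm hχ hw hp
  exact ⟨⟨fun p hp => (main p hp).1.1.contDiffWithinAt, fun p hp => (main p hp).1.2⟩,
    fun p hp => (main p hp).2.1.contDiffWithinAt, fun p hp => (main p hp).2.2⟩
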